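/- Let $M$ be a smooth ($C^\infty$) Hausdorff manifold without boundary of dimension $n$, with a pseudo-Riemannian metric $g$ of arbitrary signature (for instance a space-time), Levi-Civita connection $\nabla$ and curvature $R(Y,Z)X=\nabla_Y\nabla_ZX-\nabla_Z\nabla_YX-\nabla_{[Y,Z]}X$. Let $\Omega$ be a $p$-foliation of $M$, i.e. a smooth rank $p$ subbundle of $TM$ that has a leaf (an injectively immersed $p$-dimensional integral submanifold) through every point. Vector fields are smooth and may be defined only locally; $X\in\Omega$ means that $X$ takes its values in $\Omega$. Call $\Omega$ self-stable if $\nabla_YX\in\Omega$ for all vector fields $X,Y\in\Omega$, and regularly self-stable if around every point there is a local basis $X_1,\dots,X_p$ of $\Omega$ by smooth vector fields such that $\nabla_YX_i=0$ for $i=1,\dots,p$ and every vector field $Y\in\Omega$. Then: 1. If $\Omega$ is self-stable, then $\Omega$ is regularly self-stable if and only if $R(Y,Z)X=0$ for all $X,Y,Z\in\Omega$. 2. $\Omega$ is regularly self-stable if and only if it is totally geodesic and flat, i.e. if and only if all its leaves are totally geodesic submanifolds and flat submanifolds. Here a leaf is totally geodesic if $\nabla_XY$ is tangent to it whenever $X,Y$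 are tangent to it, and flat if the curvature of its induced connection vanishes. The induced connection is the Levi-Civita connection of the induced metric when this metric is nondegenerate, and the restriction of $\nabla$ to the leaf when the leaf is totally geodesic (the two agree when both apply). -/

import Mathlib

open Bundle Set
open scoped Manifold ContDiff Topology

universe u

noncomputable section

/-- A (not necessarily smooth) vector field on an `n`-dimensional manifold `M`. -/
abbrev VField (n : ℕ) (M : Type*) [TopologicalSpace M]
    [ChartedSpace (EuclideanSpace ℝ (Fin n)) M] : Type _ :=
  Π x : M, TangentSpace (𝓡 n) x

/-- An affine connection on `M`: a covariant derivative on the tangent bundle. Mathlib writes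
`D X x v` for the value at `x` of `∇_v X`, where `v` is a tangent vector at `x`. -/
abbrev AffineConnection (n : ℕ) (M : Type*) [TopologicalSpace M]
    [ChartedSpace (EuclideanSpace ℝ (Fin n)) M] [IsManifold (𝓡 n) ∞ M] : Type _ :=
  CovariantDerivative (𝓡 n) (EuclideanSpace ℝ (Fin n)) (TangentSpace (𝓡 n) : M → Type _)

section Manifold

variable {n : ℕ} {M : Type u} [TopologicalSpace M]
  [ChartedSpace (EuclideanSpace ℝ (Fin n)) M] [IsManifold (𝓡 n) ∞ M]

/-- The vector field `X` is smooth on `U`. Fields that are only defined on an open set `U` are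
represented by total functions, whose values outside `U` are irrelevant. -/
def SmoothFieldOn (X : VField n M) (U : Set M) : Prop :=
  ContMDiffOn (𝓡 n) (𝓡 n).tangent ∞ (fun x ↦ (⟨x, X x⟩ : TangentBundle (𝓡 n) M)) U

variable (n M) in
/-- A smooth pseudo-Riemannian metric of arbitrary signature: a smooth family of nondegenerate
symmetric bilinear forms on the tangent spaces. -/
structure PseudoRiemannianMetric where
  /-- the bilinear form on each tangent space -/
  inner (x : M) : TangentSpace (𝓡 n) x →L[ℝ] TangentSpace (𝓡 n) x →L[ℝ] ℝ
  symm (x : M) (v w : TangentSpace (𝓡 n) x) : inner x v w = inner x w v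
  nondegenerate (x : M) (v : TangentSpace (𝓡 n) x) (hv : ∀ w, inner x v w = 0) : v = 0
  contMDiff : ContMDiff (𝓡 n)
    ((𝓡 n).prod 𝓘(ℝ, EuclideanSpace ℝ (Fin n) →L[ℝ] EuclideanSpace ℝ (Fin n) →L[ℝ] ℝ)) ∞
    (fun x ↦ TotalSpace.mk' (EuclideanSpace ℝ (Fin n) →L[ℝ] EuclideanSpace ℝ (Fin n) →L[ℝ] ℝ)
      (E := fun x : M ↦ TangentSpace (𝓡 n) x →L[ℝ] TangentSpace (𝓡 n) x →L[ℝ] ℝ) x (inner x))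

/-- The affine connection `D` is smooth, torsion-free, and metric with respect to the family of
bilinear forms `b`: `v (b (X, Y)) = b (∇_v X, Y) + b (X, ∇_v Y)`.
If `b` is a pseudo-Riemannian metric, this says that `D` is its Levi-Civita connection. -/
structure IsTorsionFreeMetric
    (b : Π x : M, TangentSpace (𝓡 n) x → TangentSpace (𝓡 n) x → ℝ)
    (D : AffineConnection n M) : Prop where
  smooth : D.ContMDiffCovariantDerivative ∞
  torsion_eq_zero : D.torsion = 0
  metric (x : M) (X Y : VField n M)
    (hX : MDifferentiableAt (𝓡 n) (𝓡 n).tangent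
      (fun y ↦ (⟨y, X y⟩ : TangentBundle (𝓡 n) M)) x)
    (hY : MDifferentiableAt (𝓡 n) (𝓡 n).tangent
      (fun y ↦ (⟨y, Y y⟩ : TangentBundle (𝓡 n) M)) x)
    (v : TangentSpace (𝓡 n) x) :
    mvfderiv (𝓡 n) (fun y ↦ b y (X y) (Y y)) x v = b x (D X x v) (Y x) + b x (X x) (D Y x v)

/-- `D` is the Levi-Civita connection of the pseudo-Riemannian metric `g`. -/
def IsLeviCivita (g : PseudoRiemannianMetric n M) (D : AffineConnection n M) : Prop :=
  IsTorsionFreeMetric (fun x v w ↦ g.inner x v w) D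

/-- The covariant derivative `∇_Y X`, as a vector field. -/
def covField (D : AffineConnection n M) (Y X : VField n M) : VField n M :=
  fun x ↦ D X x (Y x)

/-- The Riemann curvature `R (Y, Z) X = ∇_Y ∇_Z X - ∇_Z ∇_Y X - ∇_[Y, Z] X`. -/
def riemannCurvature (D : AffineConnection n M) (Y Z X : VField n M) : VField n M :=
  covField D Y (covField D Z X) - covField D Z (covField D Y X)
    - covField D (VectorField.mlieBracket (𝓡 n) Y Z) X

/-- The affine connection `D` has vanishing curvature. -/
def IsFlatConnection (D : AffineConnection n M) : Prop :=
  ∀ U : Set M, IsOpen U → ∀ X Y Z : VField n M,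
    SmoothFieldOn X U → SmoothFieldOn Y U → SmoothFieldOn Z U →
      ∀ x ∈ U, riemannCurvature D Y Z X x = 0

variable {p : ℕ}

/-- The fields `X 1, …, X p` form a smooth basis, over `U`, of the family of subspaces `Ω`. -/
structure IsBasisOn (Ω : Π x : M, Submodule ℝ (TangentSpace (𝓡 n) x))
    (X : Fin p → VField n M) (U : Set M) : Prop where
  smooth (i : Fin p) : SmoothFieldOn (X i) U
  linearIndependent (x : M) (hx : x ∈ U) : LinearIndependent ℝ (fun i ↦ X i x)
  span_eq (x : M) (hx : x ∈ U) : Submodule.span ℝ (range fun i ↦ X i x) = Ω x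

variable (n M p) in
/-- A smooth `p`-distribution: a rank `p` subbundle of the tangent bundle, locally spanned by `p`
linearly independent smooth vector fields. -/
structure TangentDistribution where
  /-- the subspace of each tangent space -/
  space (x : M) : Submodule ℝ (TangentSpace (𝓡 n) x)
  exists_basis (x : M) : ∃ U : Set M, IsOpen U ∧ x ∈ U ∧
    ∃ X : Fin p → VField n M, IsBasisOn space X U

namespace TangentDistribution

/-- `X` is a smooth vector field of `Ω`, defined on `U`. -/
structure IsFieldOn (Ω : TangentDistribution n M p) (X : VField n M) (U : Set M) : Prop where
  smooth : SmoothFieldOn X U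
  mem (x : M) (hx : x ∈ U) : X x ∈ Ω.space x

/-- `Ω` is self-stable: `∇_Y X ∈ Ω` for all vector fields `X, Y ∈ Ω`. -/
def IsSelfStable (D : AffineConnection n M) (Ω : TangentDistribution n M p) : Prop :=
  ∀ U : Set M, IsOpen U → ∀ X Y : VField n M, Ω.IsFieldOn X U → Ω.IsFieldOn Y U →
    ∀ x ∈ U, covField D Y X x ∈ Ω.space x

/-- `Ω` is regularly self-stable: around every point there is a basis `X 1, …, X p` of `Ω` such
that `∇_Y (X i) = 0` for all `i` and all vector fields `Y ∈ Ω`. -/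
def IsRegularlySelfStable (D : AffineConnection n M) (Ω : TangentDistribution n M p) : Prop :=
  ∀ x : M, ∃ U : Set M, IsOpen U ∧ x ∈ U ∧ ∃ X : Fin p → VField n M, IsBasisOn Ω.space X U ∧
    ∀ Y : VField n M, Ω.IsFieldOn Y U → ∀ i, ∀ y ∈ U, covField D Y (X i) y = 0

/-- `R (Y, Z) X = 0` for all vector fields `X, Y, Z ∈ Ω`. -/
def CurvatureVanishesOn (D : AffineConnection n M) (Ω : TangentDistribution n M p) : Prop :=
  ∀ U : Set M, IsOpen U → ∀ X Y Z : VField n M,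
    Ω.IsFieldOn X U → Ω.IsFieldOn Y U → Ω.IsFieldOn Z U →
      ∀ x ∈ U, riemannCurvature D Y Z X x = 0

/-- A leaf (integral submanifold) of the `p`-distribution `Ω`: a `p`-dimensional smooth manifold
with an injective immersion into `M` whose tangent spaces are the subspaces of `Ω`. -/
structure Leaf (Ω : TangentDistribution n M p) where
  /-- the underlying `p`-dimensional manifold -/
  carrier : Type u
  [topology : TopologicalSpace carrier]
  [charts : ChartedSpace (EuclideanSpace ℝ (Fin p)) carrier]
  [isManifold : IsManifold (𝓡 p) ∞ carrier]
  /-- the inclusion into `M` -/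
  incl : carrier → M
  smooth : ContMDiff (𝓡 p) (𝓡 n) ∞ incl
  injective : Function.Injective incl
  immersion (y : carrier) : Function.Injective (mfderiv (𝓡 p) (𝓡 n) incl y)
  tangent (y : carrier) :
    LinearMap.range (mfderiv (𝓡 p) (𝓡 n) incl y).toLinearMap = Ω.space (incl y)

attribute [instance] Leaf.topology Leaf.charts Leaf.isManifold

/-- `Ω` is a foliation: it has a leaf through every point. -/
def IsFoliation (Ω : TangentDistribution n M p) : Prop :=
  ∀ x : M, ∃ L : Ω.Leaf, x ∈ range L.incl

namespace Leaf

variable {Ω : TangentDistribution n M p}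

/-- The tangent map of the inclusion of a leaf. -/
def push (L : Ω.Leaf) (y : L.carrier) :
    TangentSpace (𝓡 p) y →L[ℝ] TangentSpace (𝓡 n) (L.incl y) :=
  mfderiv (𝓡 p) (𝓡 n) L.incl y

/-- The metric induced on a leaf (it may be degenerate). -/
def inducedForm (g : PseudoRiemannianMetric n M) (L : Ω.Leaf) (y : L.carrier) :
    TangentSpace (𝓡 p) y → TangentSpace (𝓡 p) y → ℝ :=
  fun v w ↦ g.inner (L.incl y) (L.push y v) (L.push y w)

/-- The leaf `L` is a totally geodesic submanifold: if a vector field `Y` is tangent to `L` along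
an open subset `W` of `L`, then so are its covariant derivatives in directions tangent to `L`
(the second fundamental form vanishes). -/
def IsTotallyGeodesic (D : AffineConnection n M) (L : Ω.Leaf) : Prop :=
  ∀ W : Set L.carrier, IsOpen W → ∀ U : Set M, IsOpen U → MapsTo L.incl W U →
    ∀ Y : VField n M, SmoothFieldOn Y U → (∀ y ∈ W, Y (L.incl y) ∈ range (L.push y)) →
      ∀ y ∈ W, ∀ v : TangentSpace (𝓡 p) y, D Y (L.incl y) (L.push y v) ∈ range (L.push y)

/-- `D'` is the restriction of `D` to the leaf `L`: if the field `Y'` on `L` and the field `Y`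
on `M` agree along `L`, then so do their covariant derivatives in directions tangent to `L`. -/
def IsRestriction (D : AffineConnection n M) (L : Ω.Leaf)
    (D' : AffineConnection p L.carrier) : Prop :=
  ∀ W : Set L.carrier, IsOpen W → ∀ U : Set M, IsOpen U → MapsTo L.incl W U →
    ∀ (Y' : VField p L.carrier) (Y : VField n M), SmoothFieldOn Y' W → SmoothFieldOn Y U →
      (∀ y ∈ W, L.push y (Y' y) = Y (L.incl y)) →
      ∀ y ∈ W, ∀ v : TangentSpace (𝓡 p) y, L.push y (D' Y' y v) = D Y (L.incl y) (L.push y v)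

/-- `D'` is the connection induced on the leaf `L`. If the induced metric is nondegenerate, the
first clause says that `D'` is its Levi-Civita connection (and implies the second clause). If the
induced metric is degenerate but `L` is totally geodesic, the second clause determines `D'` (and
implies the first clause). -/
structure IsInducedConnection (g : PseudoRiemannianMetric n M) (D : AffineConnection n M)
    (L : Ω.Leaf) (D' : AffineConnection p L.carrier) : Prop where
  torsionFreeMetric : IsTorsionFreeMetric (L.inducedForm g) D'
  restriction : L.IsTotallyGeodesic D → L.IsRestriction D D'

/-- The leaf `L` is a flat submanifold: the curvature of its induced connection vanishes. -/
def IsFlat (g : PseudoRiemannianMetric n M) (D : AffineConnection n M) (L : Ω.Leaf) : Prop :=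
  ∃ D' : AffineConnection p L.carrier, L.IsInducedConnection g D D' ∧ IsFlatConnection D'

end Leaf

/-- All leaves of `Ω` are totally geodesic submanifolds. -/
def IsTotallyGeodesic (D : AffineConnection n M) (Ω : TangentDistribution n M p) : Prop :=
  ∀ L : Ω.Leaf, L.IsTotallyGeodesic D

/-- All leaves of `Ω` are flat submanifolds. -/
def IsFlat (g : PseudoRiemannianMetric n M) (D : AffineConnection n M)
    (Ω : TangentDistribution n M p) : Prop :=
  ∀ L : Ω.Leaf, L.IsFlat g D

end TangentDistribution

end Manifold

end

/-!
The whole theorem rests on one fact: a self-stable distribution `Ω` on which the curvature vanishes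
has local bases of fields that are parallel in the directions of `Ω`
(`IsSelfStable.isRegularlySelfStable`). Self-stability lets `∇` act as a partial connection on the
bundle `Ω` in the directions of `Ω`, and `Ω` is involutive because `∇` has no torsion. Dualizing a
`p`-dimensional linear image of the coordinates gives a basis of `Ω` whose fields commute
(`IsAdaptedFrame`). In such a basis the vanishing of the curvature is the integrability condition of
the system `∇_Y X = 0` for the coefficients of `X` (`connCoeff_integrable`): it says that the
horizontal lifts of the basis fields to `E × V`, where `E` is the coordinate space and `V` the space
of coefficients, commute as well. The system is therefore solved by first integrals of commuting
fields (`exists_firstIntegral`), linearized in the fibre direction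
(`exists_parallel_trivialization`).

The first integral of a point `z` is the point where its orbit under the commuting fields meets the
fibre through the base point. Smooth dependence of orbits on the initial value and the velocity is
obtained from the implicit function theorem, applied to the integral equation in the Banach space of
continuous paths; this needs only that composition with a smooth map is a smooth operator on
that space. That the map is constant along the fields follows since the linearized equation has
the explicit solution `(1 - t) B(y(t)) v` (`linearized_solution`).

Conversely, if `Ω` is regularly self-stable, every field of `Ω` is a combination of parallel fields,
and `∇` merely differentiates the coefficients. Hence derivatives stay in `Ω`, and the curvature,
which becomes the commutator of derivations minus the bracket, vanishes.

On leaves, the same computation holds along the inclusion map (`covariantDerivative_along`,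
`covariantDerivative_push`): leaves are totally geodesic, and differentiating the coefficients with
respect to parallel fields defines a flat torsion-free connection on each leaf, compatible with the
possibly degenerate induced metric because scalar products of parallel fields are constant
(`exists_isParallelConnection`, `isInducedConnection`, `isFlatConnection`). If, on the other hand,
all leaves are totally geodesic and flat, then `Ω` is self-stable, as there is a leaf through every
point, and by the Gauss equation (`push_riemannCurvature`) the curvature of `∇` on `Ω` is that of
the leaves, namely zero.
-/

noncomputable section

/-! ### Superposition operators on spaces of paths -/

section PathSpace

open Filter

variable {K : Type*} [TopologicalSpace K] [CompactSpace K]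
  {E F : Type u} [NormedAddCommGroup E] [NormedSpace ℝ E] [NormedAddCommGroup F] [NormedSpace ℝ F]

-- Shortcut instances: the general search for a norm on these spaces is very slow.
instance pathOperatorNormedAddCommGroup : NormedAddCommGroup C(K, E →L[ℝ] F) :=
  ContinuousMap.instNormedAddCommGroup

instance pathOperatorNormedSpace : NormedSpace ℝ C(K, E →L[ℝ] F) := ContinuousMap.normedSpace

instance pathMapNormedAddCommGroup : NormedAddCommGroup (C(K, E) →L[ℝ] C(K, F)) :=
  ContinuousLinearMap.toNormedAddCommGroup

instance pathMapNormedSpace : NormedSpace ℝ (C(K, E) →L[ℝ] C(K, F)) :=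
  ContinuousLinearMap.toNormedSpace

variable (K E F) in
/-- Pointwise application of a continuous family of operators to a continuous family of vectors,
as a bounded bilinear map. -/
def pathApply : C(K, E →L[ℝ] F) →L[ℝ] C(K, E) →L[ℝ] C(K, F) :=
  LinearMap.mkContinuous₂
    (LinearMap.mk₂ ℝ (fun (a : C(K, E →L[ℝ] F)) (u : C(K, E)) ↦
      (⟨fun t ↦ a t (u t), a.continuous.clm_apply u.continuous⟩ : C(K, F)))
      (fun a b u ↦ by ext; simp) (fun c a u ↦ by ext; simp)
      (fun a u v ↦ by ext; simp) (fun c a u ↦ by ext; simp)) 1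
    (fun a u ↦ by
      rw [one_mul, ContinuousMap.norm_le _ (by positivity)]
      intro t
      exact ((a t).le_opNorm _).trans (mul_le_mul (a.norm_coe_le_norm t) (u.norm_coe_le_norm t)
        (norm_nonneg _) (norm_nonneg _)))

@[simp] lemma pathApply_apply (a : C(K, E →L[ℝ] F)) (u : C(K, E)) (t : K) :
    pathApply K E F a u t = a t (u t) := rfl

/-- The superposition operator `u ↦ f ∘ u` is differentiable if `f` is continuously differentiable:
its derivative at `u` is multiplication by `f' ∘ u`. -/
lemma hasFDerivAt_continuousMap_comp (f : C(E, F)) (f' : C(E, E →L[ℝ] F))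
    (hf : ∀ x, HasFDerivAt f (f' x) x) (u : C(K, E)) :
    HasFDerivAt (fun v : C(K, E) ↦ f.comp v) (pathApply K E F (f'.comp u)) u := by
  refine .of_isLittleO (Asymptotics.isLittleO_iff.2 fun c hc ↦ ?_)
  have hcont : ContinuousAt (fun v : C(K, E) ↦ f'.comp v) u :=
    (ContinuousMap.continuous_postcomp f').continuousAt
  obtain ⟨δ, hδ, h⟩ := Metric.continuousAt_iff.1 hcont c hc
  filter_upwards [Metric.ball_mem_nhds u hδ] with v hv
  rw [ContinuousMap.norm_le _ (by positivity)]
  intro t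
  have key := Convex.norm_image_sub_le_of_norm_hasFDerivWithin_le' (f := f) (C := c)
    (s := segment ℝ (u t) (v t)) (x := u t) (y := v t) (f' := f') (φ := f' (u t))
    (fun x _ ↦ (hf x).hasFDerivWithinAt) ?_ (convex_segment _ _) (left_mem_segment _ _ _)
    (right_mem_segment _ _ _)
  · refine key.trans ?_
    gcongr
    exact (v - u).norm_coe_le_norm t
  · -- a point of the segment at time `t` is the value at `t` of a path of the segment `[u, v]`
    rintro _ ⟨a, b, ha, hb, hab, rfl⟩
    have hw : a • u + b • v ∈ Metric.ball u δ :=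
      (convex_ball u δ) (Metric.mem_ball_self hδ) hv ha hb hab
    have := h hw
    rw [dist_eq_norm] at this
    exact ((f'.comp (a • u + b • v) - f'.comp u).norm_coe_le_norm t).trans this.le

/-- The superposition operator `u ↦ f ∘ u` on continuous functions on a compact space is of class
`C^n` if `f` is. -/
lemma contDiff_nat_continuousMap_comp (n : ℕ) :
    ∀ {F : Type u} [NormedAddCommGroup F] [NormedSpace ℝ F] (f : C(E, F)), ContDiff ℝ n f →
      ContDiff ℝ n (fun v : C(K, E) ↦ f.comp v) := by
  induction n with
  | zero =>
    intro F _ _ f _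
    exact contDiff_zero.2 (ContinuousMap.continuous_postcomp f)
  | succ n ih =>
    intro F _ _ f hf
    obtain ⟨f', hf', h⟩ := contDiff_succ_iff_hasFDerivAt.1 (by exact_mod_cast hf)
    let g : C(E, E →L[ℝ] F) := ⟨f', hf'.continuous⟩
    have := contDiff_succ_iff_hasFDerivAt.2 ⟨fun u : C(K, E) ↦ pathApply K E F (g.comp u),
      (pathApply K E F).contDiff.comp (ih g hf'), fun u ↦ hasFDerivAt_continuousMap_comp f g h u⟩
    exact_mod_cast this

lemma contDiff_continuousMap_comp (f : C(E, F)) (hf : ContDiff ℝ ∞ f) :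
    ContDiff ℝ ∞ (fun v : C(K, E) ↦ f.comp v) :=
  contDiff_infty.2 fun n ↦ contDiff_nat_continuousMap_comp n f (contDiff_infty.1 hf n)

variable (E) in
/-- The integration operator `f ↦ ∫₀ᵗ f` on paths parametrized by the unit interval. -/
def pathIntegral : C(Icc (0 : ℝ) 1, E) →L[ℝ] C(Icc (0 : ℝ) 1, E) :=
  LinearMap.mkContinuous
    { toFun := fun f ↦ ⟨fun t ↦ ∫ s in (0 : ℝ)..t, f (projIcc 0 1 zero_le_one s),
        (intervalIntegral.continuous_primitive (fun a b ↦
          (f.continuous.comp continuous_projIcc).intervalIntegrable a b) 0).comp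
          continuous_subtype_val⟩
      map_add' := fun f g ↦ by
        ext t
        exact intervalIntegral.integral_add
          ((f.continuous.comp continuous_projIcc).intervalIntegrable _ _)
          ((g.continuous.comp continuous_projIcc).intervalIntegrable _ _)
      map_smul' := fun c f ↦ by
        ext t
        exact intervalIntegral.integral_smul c _ } 1
    (fun f ↦ by
      rw [ContinuousMap.norm_le _ (by positivity)]
      intro t
      refine (intervalIntegral.norm_integral_le_of_norm_le_const (C := ‖f‖)
        fun s _ ↦ f.norm_coe_le_norm _).trans ?_
      rw [one_mul, sub_zero, abs_of_nonneg t.2.1]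
      exact mul_le_of_le_one_right (norm_nonneg _) t.2.2)

end PathSpace

/-! ### The implicit function theorem and first integrals -/

section Implicit

open Filter

variable {E₁ E₂ F : Type*} [NormedAddCommGroup E₁] [NormedSpace ℝ E₁] [CompleteSpace E₁]
  [NormedAddCommGroup E₂] [NormedSpace ℝ E₂] [CompleteSpace E₂]
  [NormedAddCommGroup F] [NormedSpace ℝ F] [CompleteSpace F]

/-- Implicit function theorem for a smooth equation: the implicit function is smooth on a
neighbourhood of the base point, and the partial derivative of the equation remains invertible
there. -/
lemma exists_implicitFunction_contDiffAt {f : E₁ × E₂ → F} (hf : ContDiff ℝ ∞ f) (a : E₁ × E₂)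
    (ha : (fderiv ℝ f a ∘L .inr ℝ E₁ E₂).IsInvertible) :
    ∃ ψ : E₁ → E₂, ψ a.1 = a.2 ∧ ∀ᶠ x in 𝓝 a.1, ContDiffAt ℝ ∞ ψ x ∧ f (x, ψ x) = f a ∧
      (fderiv ℝ f (x, ψ x) ∘L .inr ℝ E₁ E₂).IsInvertible := by
  have h0 : (∞ : WithTop ℕ∞) ≠ 0 := by simp
  have hfa := hf.contDiffAt (x := a)
  let ψ := hfa.implicitFunction h0 ha
  have hψa : ψ a.1 = a.2 := hfa.implicitFunction_apply_self h0 ha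
  have hψ1 : ContDiffAt ℝ 1 ψ a.1 :=
    (hfa.contDiffAt_implicitFunction h0 ha).of_le (by exact_mod_cast le_top)
  have hcont : ∀ᶠ x in 𝓝 a.1, ContinuousAt ψ x :=
    (hψ1.eventually (by simp)).mono fun x hx ↦ hx.continuousAt
  have heq : ∀ᶠ x in 𝓝 a.1, f (x, ψ x) = f a := hfa.eventually_apply_implicitFunction h0 ha
  have hinv : ∀ᶠ x in 𝓝 a.1, (fderiv ℝ f (x, ψ x) ∘L .inr ℝ E₁ E₂).IsInvertible := by
    have hc : ContinuousAt (fun x ↦ fderiv ℝ f (x, ψ x) ∘L .inr ℝ E₁ E₂) a.1 := by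
      have h1 : Continuous fun b ↦ fderiv ℝ f b ∘L .inr ℝ E₁ E₂ :=
        (hf.continuous_fderiv h0).clm_comp continuous_const
      exact h1.continuousAt.comp (continuousAt_id.prodMk hψ1.continuousAt)
    have ha' : (fderiv ℝ f (a.1, ψ a.1) ∘L .inr ℝ E₁ E₂) ∈
        range (ContinuousLinearEquiv.toContinuousLinearMap : (E₂ ≃L[ℝ] F) → _) := by
      rw [hψa]; exact ha
    exact hc (ContinuousLinearEquiv.isOpen.mem_nhds ha')
  refine ⟨ψ, hψa, ?_⟩
  filter_upwards [hcont, heq, hinv, heq.eventually_nhds] with x hx hxe hxi hxn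
  refine ⟨?_, hxe, hxi⟩
  -- near `x`, `ψ` is the implicit function based at `(x, ψ x)`
  have hfx := hf.contDiffAt (x := (x, ψ x))
  have h1 : ContDiffAt ℝ ∞ (hfx.implicitFunction h0 hxi) x :=
    hfx.contDiffAt_implicitFunction h0 hxi
  refine h1.congr_of_eventuallyEq ?_
  have h2 := (continuousAt_id.prodMk hx).eventually
    (hfx.eventually_apply_eq_iff_implicitFunction h0 hxi)
  filter_upwards [h2, hxn] with y hy hyn
  exact (hy.1 (hyn.trans hxe.symm)).symm

end Implicit

section FirstIntegral

open Filter

variable {P Z : Type} [NormedAddCommGroup P] [NormedSpace ℝ P]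
  [NormedAddCommGroup Z] [NormedSpace ℝ Z] [CompleteSpace Z]

/-- If `y` solves `y' = B(y) u` on the unit interval (in integral form), where the fields `B(·) v`
commute along `y`, then `t ↦ (1 - t) B(y(t)) v` solves the linearization of that equation, in the
direction in which the parameter `u` moves with velocity `-v` and the initial value with velocity
`B(y(0)) v`. -/
lemma linearized_solution (B : C(Z, P →L[ℝ] Z)) (B' : C(Z, Z →L[ℝ] P →L[ℝ] Z))
    (hB : ∀ z, HasFDerivAt B (B' z) z) (y : C(Icc (0 : ℝ) 1, Z)) (u v : P) (z : Z)
    (hy : y = .const _ z + pathIntegral Z (pathApply _ P Z (B.comp y) (.const _ u)))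
    (hcomm : ∀ t, B' (y t) (B (y t) u) v = B' (y t) (B (y t) v) u)
    (m : C(Icc (0 : ℝ) 1, Z)) (hm : ∀ t, m t = (1 - (t : ℝ)) • B (y t) v) :
    m = .const _ (B z v) + pathIntegral Z
      (pathApply _ P Z (pathApply _ Z (P →L[ℝ] Z) (B'.comp y) m) (.const _ u)
        + pathApply _ P Z (B.comp y) (.const _ (-v))) := by
  let q : ℝ → Icc (0 : ℝ) 1 := projIcc 0 1 zero_le_one
  have hq : ∀ s (hs : s ∈ Icc (0 : ℝ) 1), q s = ⟨s, hs⟩ := fun s hs ↦ projIcc_of_mem _ hs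
  have hqc : Continuous q := continuous_projIcc
  let η : ℝ → Z := fun s ↦ z + ∫ r in (0 : ℝ)..s, B (y (q r)) u
  have hηy : ∀ t : Icc (0 : ℝ) 1, η t = y t := by
    intro t
    conv_rhs => rw [hy]
    rfl
  have hBu : Continuous fun r ↦ B (y (q r)) u :=
    (B.continuous.comp (y.continuous.comp hqc)).clm_apply continuous_const
  have hη : ∀ s, HasDerivAt η (B (y (q s)) u) s := fun s ↦
    ((hBu.integral_hasStrictDerivAt 0 s).hasDerivAt).const_add z
  ext t
  have ht : uIcc (0 : ℝ) t ⊆ Icc (0 : ℝ) 1 := by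
    rw [uIcc_of_le t.2.1]; exact Icc_subset_Icc_right t.2.2
  let G : C(Icc (0 : ℝ) 1, Z) :=
      (pathApply _ P Z (pathApply _ Z (P →L[ℝ] Z) (B'.comp y) m) (.const _ u)
        + pathApply _ P Z (B.comp y) (.const _ (-v)))
  have hint := intervalIntegral.integral_eq_sub_of_hasDerivAt (a := 0) (b := (t : ℝ))
    (f := fun s ↦ (1 - s) • B (η s) v) (f' := fun s ↦ G (q s)) ?_
    ((G.continuous.comp hqc).intervalIntegrable _ _)
  · have h0 : η 0 = z := by simp [η]
    change m t = B z v + ∫ s in (0 : ℝ)..t, G (q s)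
    rw [hint, hm, hηy]
    simp [h0]
  · intro s hs
    have hs' := ht hs
    have hηs : η s = y (q s) := by rw [hq s hs']; exact hηy ⟨s, hs'⟩
    have h1 : HasDerivAt (fun s ↦ B (η s) v) (B' (η s) (B (y (q s)) u) v) s := by
      have := ((hB (η s)).comp_hasDerivAt s (hη s)).clm_apply (hasDerivAt_const s v)
      simpa using this
    have h2 := ((hasDerivAt_id s).const_sub 1).smul h1
    refine h2.congr_deriv ?_
    have hm' : m (q s) = (1 - s) • B (y (q s)) v := by rw [hm, hq s hs']
    simp only [G, ContinuousMap.add_apply, pathApply_apply, ContinuousMap.comp_apply,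
      ContinuousMap.const_apply, hm', hηs, hcomm]
    simp

/-- Commuting vector fields `B(·) v` that are transverse to the fibres of `pr` have, near a point
`z₀`, a complete set of first integrals: `Θ z` is the point where the orbit of `z` meets the
fibre of `pr` through `z₀`. -/
theorem exists_firstIntegral [CompleteSpace P] (B : Z → P →L[ℝ] Z) (hB : ContDiff ℝ ∞ B)
    (pr : Z →L[ℝ] P) (z₀ : Z)
    (hcomm : ∀ᶠ z in 𝓝 z₀, ∀ v w, fderiv ℝ B z (B z v) w = fderiv ℝ B z (B z w) v)
    (hpr : ∀ᶠ z in 𝓝 z₀, ∀ v, pr (B z v) = v) :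
    ∃ Θ : Z → Z, ∀ᶠ z in 𝓝 z₀, ContDiffAt ℝ ∞ Θ z ∧ (∀ v, fderiv ℝ Θ z (B z v) = 0) ∧
      (pr z = pr z₀ → Θ z = z) := by
  have h0 : (∞ : WithTop ℕ∞) ≠ 0 := by simp
  let I := Icc (0 : ℝ) 1
  let b : C(Z, P →L[ℝ] Z) := ⟨B, hB.continuous⟩
  let b' : C(Z, Z →L[ℝ] P →L[ℝ] Z) := ⟨fderiv ℝ B, hB.continuous_fderiv h0⟩
  have hb' : ∀ z, HasFDerivAt b (b' z) z := fun z ↦ (hB.differentiable h0 z).hasFDerivAt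
  let cP : P →L[ℝ] C(I, P) := ContinuousLinearMap.const ℝ I
  let cZ : Z →L[ℝ] C(I, Z) := ContinuousLinearMap.const ℝ I
  let A : C(I, P →L[ℝ] Z) →L[ℝ] C(I, P) →L[ℝ] C(I, Z) := pathApply I P Z
  -- the equation `y(t) = z + ∫₀ᵗ B(y) u` for the time-one orbit with velocity `u` from `z`
  let G : (P × Z) × C(I, Z) → C(I, Z) := fun a ↦ a.2 - cZ a.1.2
    - pathIntegral Z (A (b.comp a.2) (cP a.1.1))
  have hN : ContDiff ℝ ∞ (fun y : C(I, Z) ↦ b.comp y) := contDiff_continuousMap_comp b hB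
  have hG : ContDiff ℝ ∞ G := by
    refine (contDiff_snd.sub ?_).sub ?_
    · exact cZ.contDiff.comp (contDiff_snd.comp contDiff_fst)
    · refine (pathIntegral Z).contDiff.comp ?_
      have hA : ContDiff ℝ ∞ (fun a : (P × Z) × C(I, Z) ↦ A (b.comp a.2)) :=
        A.contDiff.comp (hN.comp contDiff_snd)
      exact hA.clm_apply (cP.contDiff.comp (contDiff_fst.comp contDiff_fst))
  have hG' : ∀ (u : P) (z : Z) (y : C(I, Z)) (du : P) (dz : Z) (h : C(I, Z)),
      fderiv ℝ G ((u, z), y) ((du, dz), h) = h - .const _ dz - pathIntegral Z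
      (pathApply _ P Z (pathApply _ Z (P →L[ℝ] Z) (b'.comp y) h) (.const _ u)
        + pathApply _ P Z (b.comp y) (.const _ du)) := by
    intro u z y du dz h
    let a : (P × Z) × C(I, Z) := ((u, z), y)
    have e1 : HasFDerivAt (fun a : (P × Z) × C(I, Z) ↦ a.2)
      (ContinuousLinearMap.snd ℝ (P × Z) C(I, Z)) a := hasFDerivAt_snd
    have e2 : HasFDerivAt (fun a : (P × Z) × C(I, Z) ↦ a.1)
      (ContinuousLinearMap.fst ℝ (P × Z) C(I, Z)) a := hasFDerivAt_fst
    have e3 := (cZ.comp (ContinuousLinearMap.snd ℝ P Z)).hasFDerivAt.comp a e2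
    have e4 := (cP.comp (ContinuousLinearMap.fst ℝ P Z)).hasFDerivAt.comp a e2
    have e5 := (hasFDerivAt_continuousMap_comp b b' hb' y).comp a e1
    have e5' : HasFDerivAt (fun a : (P × Z) × C(I, Z) ↦ A (b.comp a.2)) _ a :=
      (A.hasFDerivAt (x := b.comp y)).comp a e5
    have e6 := e5'.clm_apply e4
    have e7 := (e1.sub e3).sub ((pathIntegral Z).hasFDerivAt.comp a e6)
    have e8 : HasFDerivAt G _ a := e7
    rw [e8.fderiv]
    simp only [sub_apply, ContinuousLinearMap.comp_apply,
      add_apply, ContinuousLinearMap.flip_apply]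
    rw [add_comm]
    rfl
  let a₀ : (P × Z) × C(I, Z) := ((0, z₀), .const _ z₀)
  have hGa₀ : G a₀ = 0 := by
    ext t
    simp [G, a₀, cP, cZ]
  have hinv₀ : (fderiv ℝ G a₀ ∘L .inr ℝ (P × Z) C(I, Z)).IsInvertible := by
    refine ⟨ContinuousLinearEquiv.refl ℝ _, ?_⟩
    ext1 h
    have := hG' 0 z₀ (.const _ z₀) 0 0 h
    have hc : (ContinuousMap.const I (0 : P)) = 0 := rfl
    have hc' : (ContinuousMap.const I (0 : Z)) = 0 := rfl
    simp only [hc, hc', map_zero, add_zero, sub_zero] at this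
    exact this.symm
  obtain ⟨ψ, hψ₀, hψ⟩ := exists_implicitFunction_contDiffAt hG a₀ hinv₀
  -- close to the constant path at `z₀`, orbits stay where the fields commute
  have hstay : ∀ᶠ x in 𝓝 (0, z₀), ∀ t, ∀ v w,
      fderiv ℝ B (ψ x t) (B (ψ x t) v) w = fderiv ℝ B (ψ x t) (B (ψ x t) w) v := by
    obtain ⟨O, hO, hOo, hzO⟩ := mem_nhds_iff.1 hcomm
    have hc : ContinuousAt ψ (0, z₀) := hψ.self_of_nhds.1.continuousAt
    have hopen : IsOpen {f : C(I, Z) | MapsTo f univ O} :=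
      ContinuousMap.isOpen_setOfPred_mapsTo isCompact_univ hOo
    have hmem : ψ (0, z₀) ∈ {f : C(I, Z) | MapsTo f univ O} := by
      rw [hψ₀]; exact fun t _ ↦ hzO
    filter_upwards [hc (hopen.mem_nhds hmem)] with x hx t
    exact hO (hx (mem_univ t))
  let one : I := ⟨1, by norm_num, le_rfl⟩
  let κ : Z → P × Z := fun z ↦ (-(pr z - pr z₀), z)
  have hκ : ContDiff ℝ ∞ κ := by fun_prop
  have hκ₀ : κ z₀ = (0, z₀) := by simp [κ]
  have hκt : Tendsto κ (𝓝 z₀) (𝓝 (0, z₀)) := hκ₀ ▸ hκ.continuous.continuousAt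
  let ev : C(I, Z) →L[ℝ] Z := ContinuousMap.evalCLM ℝ one
  refine ⟨fun z ↦ ev (ψ (κ z)), ?_⟩
  filter_upwards [hκt.eventually hψ, hκt.eventually (hψ.eventually_nhds), hκt.eventually hstay, hpr]
    with z hz hzn hzs hzpr
  obtain ⟨hzd, hze, hzi⟩ := hz
  refine ⟨ev.contDiff.contDiffAt.comp z
    (hzd.comp z hκ.contDiffAt), ?_, ?_⟩
  · intro v
    have hκd : HasFDerivAt κ ((-pr).prod (ContinuousLinearMap.id ℝ Z)) z := by
      refine HasFDerivAt.prodMk ?_ (hasFDerivAt_id z)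
      exact (pr.hasFDerivAt.sub_const _).neg
    have hψd : HasFDerivAt ψ (fderiv ℝ ψ (κ z)) (κ z) :=
      (hzd.differentiableAt h0).hasFDerivAt
    have hΘ := ev.hasFDerivAt.comp z (hψd.comp z hκd)
    have hΘ' : fderiv ℝ (fun z ↦ ev (ψ (κ z))) z (B z v)
        = fderiv ℝ ψ (κ z) (-v, B z v) one := by
      refine (congrArg (fun L ↦ L (B z v)) hΘ.fderiv).trans ?_
      simp only [ContinuousLinearMap.comp_apply, ContinuousLinearMap.prod_apply,
        neg_apply, hzpr]
      rfl
    rw [hΘ']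
    let y := ψ (κ z)
    let m : C(I, Z) := ⟨fun t ↦ (1 - (t : ℝ)) • B (y t) v, by
      have := hB.continuous
      fun_prop⟩
    -- differentiate the identity `G (x, ψ x) = 0` in the direction `(-v, B z v)`
    have hd : fderiv ℝ G (κ z, y) ((-v, B z v), fderiv ℝ ψ (κ z) (-v, B z v)) = 0 := by
      have e1 : HasFDerivAt (fun x ↦ G (x, ψ x)) _ (κ z) :=
        HasFDerivAt.comp (κ z) (hG.differentiable h0 (κ z, y)).hasFDerivAt
          ((hasFDerivAt_id (κ z)).prodMk hψd)
      have e2 : HasFDerivAt (fun x ↦ G (x, ψ x)) (0 : P × Z →L[ℝ] C(I, Z)) (κ z) :=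
        (hasFDerivAt_const (G a₀) (κ z)).congr_of_eventuallyEq
          (hzn.mono fun x hx ↦ hx.2.1)
      have := congrArg (fun L ↦ L (-v, B z v)) (e1.unique e2)
      exact this
    have hm : fderiv ℝ G (κ z, y) ((-v, B z v), m) = 0 := by
      refine (hG' _ _ _ _ _ _).trans ?_
      have hy : y = .const _ z + pathIntegral Z
          (pathApply _ P Z (b.comp y) (.const _ (-(pr z - pr z₀)))) := by
        have : y - .const _ z - pathIntegral Z
          (pathApply _ P Z (b.comp y) (.const _ (-(pr z - pr z₀)))) = 0 := hze.trans hGa₀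
        rw [sub_sub, sub_eq_zero] at this
        exact this
      rw [sub_sub, sub_eq_zero]
      exact linearized_solution b b' hb' y _ v z hy (fun t ↦ hzs t _ _) m (fun t ↦ rfl)
    have hker : (fderiv ℝ G (κ z, y) ∘L .inr ℝ (P × Z) C(I, Z))
        (fderiv ℝ ψ (κ z) (-v, B z v)) =
        (fderiv ℝ G (κ z, y) ∘L .inr ℝ (P × Z) C(I, Z)) m := by
      have := hd.trans hm.symm
      rw [← sub_eq_zero, ← map_sub] at this
      simp only [Prod.mk_sub_mk, sub_self] at this
      rw [← sub_eq_zero, ← map_sub]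
      exact this
    rw [hzi.injective hker]
    simp [m, one]
  · intro h
    have hz1 : G (κ z, ψ (κ z)) = 0 := hze.trans hGa₀
    have hκz : κ z = (0, z) := by simp [κ, h]
    have := congrArg (fun f ↦ f one) hz1
    simp only [hκz, G] at this
    rw [hκz]
    simpa [sub_eq_zero, cP, cZ, ev] using this

end FirstIntegral

/-! ### Parallel trivializations of flat partial connections -/

section ParallelTransport

open Filter

variable {E F : Type*} [NormedAddCommGroup E] [NormedSpace ℝ E] [FiniteDimensional ℝ E]
  [NormedAddCommGroup F] [NormedSpace ℝ F]

/-- A map that is smooth near `x₀` has the same germ at `x₀` as a globally smooth map. -/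
lemma exists_contDiff_eventuallyEq {f : E → F} {x₀ : E} (hf : ∀ᶠ x in 𝓝 x₀, ContDiffAt ℝ ∞ f x) :
    ∃ g : E → F, ContDiff ℝ ∞ g ∧ g =ᶠ[𝓝 x₀] f := by
  obtain ⟨r, hr, hball⟩ := Metric.eventually_nhds_iff_ball.1 hf
  let χ : ContDiffBump x₀ := ⟨r / 4, r / 2, by positivity, by linarith⟩
  refine ⟨fun x ↦ χ x • f x, contDiff_iff_contDiffAt.2 fun x ↦ ?_, ?_⟩
  · by_cases hx : x ∈ Metric.ball x₀ r
    · exact χ.contDiffAt.smul (hball x hx)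
    · have hx' : x ∉ tsupport χ := by
        rw [χ.tsupport_eq]
        intro h
        rw [Metric.mem_closedBall] at h
        rw [Metric.mem_ball] at hx
        change dist x x₀ ≤ r / 2 at h
        linarith
      have h0 : (fun x ↦ χ x • f x) =ᶠ[𝓝 x] fun _ ↦ 0 := by
        filter_upwards [notMem_tsupport_iff_eventuallyEq.1 hx'] with y hy
        simp [hy]
      exact contDiffAt_const.congr_of_eventuallyEq h0
  · filter_upwards [χ.eventuallyEq_one] with x hx
    simp [hx]

variable {E P V : Type} [NormedAddCommGroup E] [NormedSpace ℝ E]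
  [NormedAddCommGroup P] [NormedSpace ℝ P] [NormedAddCommGroup V] [NormedSpace ℝ V]

lemma hasFDerivAt_comp_fst {G : Type*} [NormedAddCommGroup G] [NormedSpace ℝ G] {g : E → G}
    {x : E} (f : V) (hg : DifferentiableAt ℝ g x) :
    HasFDerivAt (fun z : E × V ↦ g z.1) (fderiv ℝ g x ∘L .fst ℝ E V) (x, f) :=
  hg.hasFDerivAt.comp (x, f) hasFDerivAt_fst

set_option synthInstance.maxHeartbeats 200000 in
/-- The commutation relation satisfied by the fields `(Y(·) a, -Γ(·) f a)` on `E × V`, the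
horizontal lifts of the fields `Y(·) a`, when the latter commute and the partial connection `Γ`
is flat. -/
lemma fderiv_horizontal_lift {Y : E → P →L[ℝ] E} {Γ : E → V →L[ℝ] P →L[ℝ] V} {x : E}
    (hY : DifferentiableAt ℝ Y x) (hΓ : DifferentiableAt ℝ Γ x) (f : V) (a b : P)
    (hcomm : fderiv ℝ Y x (Y x a) b = fderiv ℝ Y x (Y x b) a)
    (hflat : fderiv ℝ Γ x (Y x a) f b - Γ x (Γ x f a) b =
      fderiv ℝ Γ x (Y x b) f a - Γ x (Γ x f b) a) :
    let B : E × V → P →L[ℝ] E × V := fun z ↦ .inl ℝ E V ∘L Y z.1 - .inr ℝ E V ∘L Γ z.1 z.2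
    fderiv ℝ B (x, f) (B (x, f) a) b = fderiv ℝ B (x, f) (B (x, f) b) a := by
  intro B
  have hB : ∀ (w : E × V) (c : P), fderiv ℝ B (x, f) w c =
      (fderiv ℝ Y x w.1 c, -(Γ x w.2 c + fderiv ℝ Γ x w.1 f c)) := by
    intro w c
    have e1 := hasFDerivAt_comp_fst f hY
    have e2 := hasFDerivAt_comp_fst (G := V →L[ℝ] P →L[ℝ] V) f hΓ
    have e2' := e2.clm_apply (hasFDerivAt_snd (𝕜 := ℝ) (p := (x, f)))
    have e3 := (e1.clm_apply (hasFDerivAt_const c (x, f))).prodMk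
      (e2'.clm_apply (hasFDerivAt_const c (x, f))).neg
    have hBd : DifferentiableAt ℝ B (x, f) :=
      ((differentiableAt_const _).clm_comp e1.differentiableAt).sub
        ((differentiableAt_const _).clm_comp e2'.differentiableAt)
    have e4 := (hBd.hasFDerivAt.clm_apply (hasFDerivAt_const c (x, f)))
    have := congrArg (fun L ↦ L w) (e4.unique
      (e3.congr_of_eventuallyEq (.of_forall fun y ↦ by simp [B])))
    simpa [add_comm] using this
  rw [hB, hB]
  refine Prod.ext (by simpa [B] using hcomm) ?_
  simp only [B, neg_add_rev]
  simpa [neg_add_eq_sub] using congrArg Neg.neg hflat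

set_option synthInstance.maxHeartbeats 200000 in
/-- A partial connection with coefficients `Γ` along commuting fields `Y(·) a`, flat in the sense
of `hflat`, has near `x₀` a trivialization `J` that is parallel: `(Y_a J) f = J (Γ(f) a)`. It is the
linearization along the zero section of a first integral of the horizontal fields on `E × V`. -/
theorem exists_parallel_trivialization [FiniteDimensional ℝ E] [CompleteSpace P]
    [CompleteSpace V] {Y : E → P →L[ℝ] E} {Γ : E → V →L[ℝ] P →L[ℝ] V} {x₀ : E}
    (hY : ∀ᶠ x in 𝓝 x₀, ContDiffAt ℝ ∞ Y x) (hΓ : ∀ᶠ x in 𝓝 x₀, ContDiffAt ℝ ∞ Γ x)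
    (pr : E →L[ℝ] P) (hpr : ∀ᶠ x in 𝓝 x₀, ∀ a, pr (Y x a) = a)
    (hcomm : ∀ᶠ x in 𝓝 x₀, ∀ a b, fderiv ℝ Y x (Y x a) b = fderiv ℝ Y x (Y x b) a)
    (hflat : ∀ᶠ x in 𝓝 x₀, ∀ f a b, fderiv ℝ Γ x (Y x a) f b - Γ x (Γ x f a) b =
      fderiv ℝ Γ x (Y x b) f a - Γ x (Γ x f b) a) :
    ∃ J : E → V →L[ℝ] V, J x₀ = .id ℝ V ∧
      ∀ᶠ x in 𝓝 x₀, ContDiffAt ℝ ∞ J x ∧ ∀ a f, fderiv ℝ J x (Y x a) f = J x (Γ x f a) := by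
  have : CompleteSpace E := FiniteDimensional.complete ℝ E
  have h0 : (∞ : WithTop ℕ∞) ≠ 0 := by simp
  obtain ⟨Y', hY', hYY'⟩ := exists_contDiff_eventuallyEq hY
  obtain ⟨Γ', hΓ', hΓΓ'⟩ := exists_contDiff_eventuallyEq hΓ
  have hcomm' : ∀ᶠ x in 𝓝 x₀, ∀ a b, fderiv ℝ Y' x (Y' x a) b = fderiv ℝ Y' x (Y' x b) a := by
    filter_upwards [hcomm, hYY'.eventuallyEq_nhds] with x hx hx'
    rw [hx'.fderiv_eq, hx'.self_of_nhds]; exact hx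
  have hflat' : ∀ᶠ x in 𝓝 x₀, ∀ f a b, fderiv ℝ Γ' x (Y' x a) f b - Γ' x (Γ' x f a) b =
      fderiv ℝ Γ' x (Y' x b) f a - Γ' x (Γ' x f b) a := by
    filter_upwards [hflat, hYY', hΓΓ'.eventuallyEq_nhds] with x hx hx' hx''
    rw [hx''.fderiv_eq, hx''.self_of_nhds, hx']; exact hx
  let B : E × V → P →L[ℝ] E × V := fun z ↦ .inl ℝ E V ∘L Y' z.1 - .inr ℝ E V ∘L Γ' z.1 z.2
  have hB : ContDiff ℝ ∞ B := by
    exact (contDiff_const.clm_comp (hY'.comp contDiff_fst)).sub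
      (contDiff_const.clm_comp ((hΓ'.comp contDiff_fst).clm_apply contDiff_snd))
  have hfst : Tendsto (Prod.fst : E × V → E) (𝓝 (x₀, 0)) (𝓝 x₀) := continuous_fst.continuousAt
  obtain ⟨Θ, hΘ⟩ := exists_firstIntegral B hB (pr ∘L .fst ℝ E V) (x₀, 0)
    (by
      filter_upwards [hfst.eventually hcomm', hfst.eventually hflat'] with z h1 h2 a b
      exact fderiv_horizontal_lift (hY'.differentiable h0 z.1) (hΓ'.differentiable h0 z.1) z.2 a b
        (h1 a b) (h2 z.2 a b))
    (by
      filter_upwards [hfst.eventually hpr, hfst.eventually hYY'] with z h1 h2 a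
      simp [B, h2, h1])
  let L : (E × V →L[ℝ] E × V) →L[ℝ] V →L[ℝ] V :=
    (ContinuousLinearMap.compL ℝ V (E × V) V (.snd ℝ E V)) ∘L
      (ContinuousLinearMap.compL ℝ V (E × V) (E × V)).flip (.inr ℝ E V)
  have hL : ∀ T h, L T h = (T (0, h)).2 := fun T h ↦ rfl
  let σ : E → E × V := fun x ↦ (x, 0)
  have hσ : ContDiff ℝ ∞ σ := contDiff_id.prodMk contDiff_const
  have hσt : Tendsto σ (𝓝 x₀) (𝓝 (x₀, 0)) := hσ.continuous.continuousAt
  have hΘ0 : ContDiffAt ℝ ∞ Θ (x₀, 0) := hΘ.self_of_nhds.1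
  refine ⟨fun x ↦ L (fderiv ℝ Θ (σ x)), ?_, ?_⟩
  · -- `Θ` is the identity on the fibre over `x₀`
    have e1 : HasFDerivAt (fun f : V ↦ Θ (x₀, f)) _ 0 :=
      HasFDerivAt.comp (0 : V) (f := fun f : V ↦ (x₀, f)) (g := Θ)
        (hΘ0.differentiableAt h0).hasFDerivAt (hasFDerivAt_prodMk_right x₀ 0)
    have e2 : HasFDerivAt (fun f : V ↦ Θ (x₀, f)) (.inr ℝ E V) 0 := by
      refine (hasFDerivAt_prodMk_right x₀ 0).congr_of_eventuallyEq ?_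
      have ht : Tendsto (fun f : V ↦ (x₀, f)) (𝓝 0) (𝓝 (x₀, 0)) :=
        (Continuous.prodMk_right x₀).continuousAt
      filter_upwards [ht.eventually hΘ] with f hf
      exact hf.2.2 rfl
    ext h
    have := congrArg (fun T ↦ (T h).2) (e1.unique e2)
    exact this
  · have hΘn := hσt.eventually hΘ.eventually_nhds
    filter_upwards [hσt.eventually hΘ, hΘn, hYY', hΓΓ'] with x hx hxn hxY hxΓ
    have hdΘ : ContDiffAt ℝ ∞ (fderiv ℝ Θ) (σ x) :=
      hx.1.fderiv_right (by simp)
    have hdd := (hdΘ.differentiableAt h0).hasFDerivAt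
    refine ⟨L.contDiff.contDiffAt.comp x (hdΘ.comp x hσ.contDiffAt), fun a h ↦ ?_⟩
    have hJ : HasFDerivAt (fun x ↦ L (fderiv ℝ Θ (σ x))) _ x :=
      L.hasFDerivAt.comp x (hdd.comp x ((hasFDerivAt_id x).prodMk (hasFDerivAt_const (0 : V) x)))
    rw [hJ.fderiv]
    have h2 : (2 : WithTop ℕ∞) ≤ ∞ := WithTop.coe_le_coe.2 le_top
    -- differentiate `dΘ (B · a) = 0` at the zero section, in the direction of the fibre
    let β : V → E × V := fun f ↦ (Y x a, -(Γ x f a))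
    have eβ : HasFDerivAt β ((0 : V →L[ℝ] E).prod (-(Γ x).flip a)) 0 :=
      (hasFDerivAt_const (Y x a) (0 : V)).prodMk ((Γ x).flip a).hasFDerivAt.neg
    have hcont : Tendsto (fun f : V ↦ (x, f)) (𝓝 0) (𝓝 (σ x)) :=
      (Continuous.prodMk_right x).continuousAt
    have e1 : HasFDerivAt (fun f : V ↦ fderiv ℝ Θ (x, f) (β f)) _ 0 :=
      (HasFDerivAt.comp (0 : V) (f := fun f : V ↦ (x, f)) (g := fderiv ℝ Θ)
        hdd (hasFDerivAt_prodMk_right x 0)).clm_apply eβ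
    have e2 : HasFDerivAt (fun f : V ↦ fderiv ℝ Θ (x, f) (β f)) (0 : V →L[ℝ] E × V) 0 := by
      refine (hasFDerivAt_const (0 : E × V) 0).congr_of_eventuallyEq ?_
      filter_upwards [hcont.eventually hxn] with f hf
      have := hf.2.1 a
      simpa [B, β, hxY, hxΓ] using this
    have e3 := congrArg (fun T ↦ T h) (e1.unique e2)
    have hsymm := (hx.1.isSymmSndFDerivAt (by simpa using h2)).eq (0, h) (Y x a, 0)
    have e4 : fderiv ℝ Θ (x, 0) (0, -(Γ x h a)) + fderiv ℝ (fderiv ℝ Θ) (σ x) (0, h) (Y x a, 0)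
        = 0 := by
      simpa [β, σ] using e3
    rw [hsymm] at e4
    have e5 : ((0 : E), -(Γ x h a)) = -((0 : E), Γ x h a) := by simp
    rw [e5, map_neg, neg_add_eq_sub, sub_eq_zero] at e4
    exact congrArg Prod.snd e4

end ParallelTransport

/-! ### Calculus of vector fields in a chart -/

section ChartDerivatives

variable {n : ℕ} {M : Type*} [TopologicalSpace M] [ChartedSpace (EuclideanSpace ℝ (Fin n)) M]
  {F : Type*} [NormedAddCommGroup F] [NormedSpace ℝ F]

lemma mvfderiv_comp_mfderiv {m : ℕ} {N : Type*} [TopologicalSpace N]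
    [ChartedSpace (EuclideanSpace ℝ (Fin m)) N] {h : M → F} {ι : N → M} {y : N}
    (hh : MDifferentiableAt (𝓡 n) 𝓘(ℝ, F) h (ι y)) (hι : MDifferentiableAt (𝓡 m) (𝓡 n) ι y)
    (v : TangentSpace (𝓡 m) y) :
    mvfderiv (𝓡 m) (fun z ↦ h (ι z)) y v
      = mvfderiv (𝓡 n) h (ι y) (mfderiv (𝓡 m) (𝓡 n) ι y v) :=
  mfderiv_comp_apply y hh hι v

lemma mvfderiv_congr {h h' : M → F} {x : M} (e : h =ᶠ[𝓝 x] h') :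
    mvfderiv (𝓡 n) h x = mvfderiv (𝓡 n) h' x := by
  ext v
  exact congrArg (fun L : TangentSpace (𝓡 n) x →L[ℝ] F ↦ L v) e.mfderiv_eq

lemma contMDiffAt_iff_contDiffAt_chart {h : M → F} {x₀ y : M} {k : WithTop ℕ∞}
    [IsManifold (𝓡 n) k M]
    (hy : y ∈ (chartAt (EuclideanSpace ℝ (Fin n)) x₀).source) :
    ContMDiffAt (𝓡 n) 𝓘(ℝ, F) k h y ↔
      ContDiffAt ℝ k (h ∘ (extChartAt (𝓡 n) x₀).symm) (extChartAt (𝓡 n) x₀ y) := by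
  rw [contMDiffAt_iff_source_of_mem_source hy, ← contMDiffAt_iff_contDiffAt]
  simp [contMDiffWithinAt_univ]

end ChartDerivatives

section FieldCalculus

variable {n : ℕ} {M : Type*} [TopologicalSpace M]
  [ChartedSpace (EuclideanSpace ℝ (Fin n)) M] [IsManifold (𝓡 n) ∞ M]

/-- The vector field `X` is smooth at `x`. -/
abbrev SmoothFieldAt (X : VField n M) (x : M) : Prop :=
  ContMDiffAt (𝓡 n) (𝓡 n).tangent ∞ (fun y ↦ (⟨y, X y⟩ : TangentBundle (𝓡 n) M)) x

/-- The vector field `X` is differentiable at `x`. -/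
abbrev DiffFieldAt (X : VField n M) (x : M) : Prop :=
  MDifferentiableAt (𝓡 n) (𝓡 n).tangent (fun y ↦ (⟨y, X y⟩ : TangentBundle (𝓡 n) M)) x

variable (n) in
/-- The differential at `y` of the chart around `x₀`. -/
def chartDeriv (x₀ y : M) : TangentSpace (𝓡 n) y →L[ℝ] EuclideanSpace ℝ (Fin n) :=
  mvfderiv (𝓡 n) (extChartAt (𝓡 n) x₀) y

lemma SmoothFieldOn.smoothFieldAt {X : VField n M} {U : Set M} (hX : SmoothFieldOn X U)
    (hU : IsOpen U) {x : M} (hx : x ∈ U) : SmoothFieldAt X x :=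
  (hX x hx).contMDiffAt (hU.mem_nhds hx)

lemma SmoothFieldAt.diffFieldAt {X : VField n M} {x : M} (hX : SmoothFieldAt X x) :
    DiffFieldAt X x :=
  hX.mdifferentiableAt (by simp)

lemma trivialization_eq_chartDeriv {x₀ y : M}
    (hy : y ∈ (chartAt (EuclideanSpace ℝ (Fin n)) x₀).source) (v : TangentSpace (𝓡 n) y) :
    (trivializationAt (EuclideanSpace ℝ (Fin n)) (TangentSpace (𝓡 n) : M → Type _) x₀
      ⟨y, v⟩).2 = chartDeriv n x₀ y v := by
  have h := TangentBundle.continuousLinearMapAt_trivializationAt (I := 𝓡 n) hy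
  have h2 := congrArg (fun L ↦ L v) h
  rw [← Trivialization.continuousLinearMapAt_apply_of_mem (R := ℝ)]
  exact h2
  exact hy

lemma smoothFieldAt_iff {X : VField n M} {x₀ y : M}
    (hy : y ∈ (chartAt (EuclideanSpace ℝ (Fin n)) x₀).source) :
    SmoothFieldAt X y ↔
      ContMDiffAt (𝓡 n) 𝓘(ℝ, EuclideanSpace ℝ (Fin n)) ∞ (fun z ↦ chartDeriv n x₀ z (X z)) y := by
  rw [SmoothFieldAt, Trivialization.contMDiffAt_section_iff (trivializationAt
    (EuclideanSpace ℝ (Fin n)) (TangentSpace (𝓡 n) : M → Type _) x₀) (by exact hy)]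
  refine Filter.EventuallyEq.contMDiffAt_iff ?_
  filter_upwards [(chartAt (EuclideanSpace ℝ (Fin n)) x₀).open_source.mem_nhds hy] with z hz
  exact trivialization_eq_chartDeriv hz _

lemma diffFieldAt_iff {X : VField n M} {x₀ y : M}
    (hy : y ∈ (chartAt (EuclideanSpace ℝ (Fin n)) x₀).source) :
    DiffFieldAt X y ↔ MDifferentiableAt (𝓡 n) 𝓘(ℝ, EuclideanSpace ℝ (Fin n))
      (fun z ↦ chartDeriv n x₀ z (X z)) y := by
  rw [DiffFieldAt, Trivialization.mdifferentiableAt_section_iff _ (trivializationAt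
    (EuclideanSpace ℝ (Fin n)) (TangentSpace (𝓡 n) : M → Type _) x₀) _ (by exact hy)]
  refine Filter.EventuallyEq.mdifferentiableAt_iff ?_
  filter_upwards [(chartAt (EuclideanSpace ℝ (Fin n)) x₀).open_source.mem_nhds hy] with z hz
  exact trivialization_eq_chartDeriv hz _

lemma chartDeriv_isInvertible {x₀ y : M}
    (hy : y ∈ (chartAt (EuclideanSpace ℝ (Fin n)) x₀).source) :
    (chartDeriv n x₀ y).IsInvertible :=
  isInvertible_mfderiv_extChartAt (I := 𝓡 n) (by simpa using hy)

lemma chartDeriv_injective {x₀ y : M}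
    (hy : y ∈ (chartAt (EuclideanSpace ℝ (Fin n)) x₀).source) :
    Function.Injective (chartDeriv n x₀ y) :=
  (chartDeriv_isInvertible hy).injective

lemma chartDeriv_surjective {x₀ y : M}
    (hy : y ∈ (chartAt (EuclideanSpace ℝ (Fin n)) x₀).source) :
    Function.Surjective (chartDeriv n x₀ y) :=
  (chartDeriv_isInvertible hy).surjective

variable {F : Type*} [NormedAddCommGroup F] [NormedSpace ℝ F]

lemma mvfderiv_eq_fderiv_chart {h : M → F} {x₀ y : M}
    (hy : y ∈ (chartAt (EuclideanSpace ℝ (Fin n)) x₀).source)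
    (hh : DifferentiableAt ℝ (h ∘ (extChartAt (𝓡 n) x₀).symm) (extChartAt (𝓡 n) x₀ y))
    (v : TangentSpace (𝓡 n) y) :
    mvfderiv (𝓡 n) h y v = fderiv ℝ (h ∘ (extChartAt (𝓡 n) x₀).symm) (extChartAt (𝓡 n) x₀ y)
      (chartDeriv n x₀ y v) := by
  have e : h =ᶠ[𝓝 y] fun z ↦ (h ∘ (extChartAt (𝓡 n) x₀).symm) (extChartAt (𝓡 n) x₀ z) := by
    filter_upwards [(chartAt (EuclideanSpace ℝ (Fin n)) x₀).open_source.mem_nhds hy] with z hz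
    simp [hz]
  rw [mvfderiv_congr e]
  have h1 : MDifferentiableAt (𝓡 n) 𝓘(ℝ, EuclideanSpace ℝ (Fin n)) (extChartAt (𝓡 n) x₀) y :=
    mdifferentiableAt_extChartAt hy
  have := mfderiv_comp_apply y hh.mdifferentiableAt h1 v
  rw [mfderiv_eq_fderiv] at this
  exact this

lemma mvfderiv_chart_comp {h : EuclideanSpace ℝ (Fin n) → F} {x₀ y : M}
    (hy : y ∈ (chartAt (EuclideanSpace ℝ (Fin n)) x₀).source)
    (hh : DifferentiableAt ℝ h (extChartAt (𝓡 n) x₀ y)) (v : TangentSpace (𝓡 n) y) :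
    mvfderiv (𝓡 n) (fun z ↦ h (extChartAt (𝓡 n) x₀ z)) y v
      = fderiv ℝ h (extChartAt (𝓡 n) x₀ y) (chartDeriv n x₀ y v) := by
  have h1 : MDifferentiableAt (𝓡 n) 𝓘(ℝ, EuclideanSpace ℝ (Fin n)) (extChartAt (𝓡 n) x₀) y :=
    mdifferentiableAt_extChartAt hy
  have := mfderiv_comp_apply y hh.mdifferentiableAt h1 v
  rw [mfderiv_eq_fderiv] at this
  exact this

lemma mdifferentiableAt_chart_symm {h : M → F} {x₀ y : M}
    (hy : y ∈ (chartAt (EuclideanSpace ℝ (Fin n)) x₀).source)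
    (hh : MDifferentiableAt (𝓡 n) 𝓘(ℝ, F) h y) :
    DifferentiableAt ℝ (h ∘ (extChartAt (𝓡 n) x₀).symm) (extChartAt (𝓡 n) x₀ y) := by
  rw [← mdifferentiableAt_iff_differentiableAt]
  have h1 := (mdifferentiableWithinAt_extChartAt_symm (I := 𝓡 n) (x := x₀)
    (z := extChartAt (𝓡 n) x₀ y) (by simpa using (chartAt _ x₀).map_source hy)).mdifferentiableAt
      (by simp)
  refine MDifferentiableAt.comp _ ?_ h1
  simpa [hy] using hh

end FieldCalculus

section FieldDerivations

variable {n : ℕ} {M : Type*} [TopologicalSpace M]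
  [ChartedSpace (EuclideanSpace ℝ (Fin n)) M]

/-- The coordinate expression of a vector field in the chart around `x₀`. -/
def chartField (x₀ : M) (X : VField n M) (z : EuclideanSpace ℝ (Fin n)) :
    EuclideanSpace ℝ (Fin n) :=
  chartDeriv n x₀ ((extChartAt (𝓡 n) x₀).symm z) (X ((extChartAt (𝓡 n) x₀).symm z))

lemma chartField_extChartAt {x₀ y : M} (X : VField n M)
    (hy : y ∈ (chartAt (EuclideanSpace ℝ (Fin n)) x₀).source) :
    chartField x₀ X (extChartAt (𝓡 n) x₀ y) = chartDeriv n x₀ y (X y) := by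
  have : (extChartAt (𝓡 n) x₀).symm (extChartAt (𝓡 n) x₀ y) = y :=
    (extChartAt (𝓡 n) x₀).left_inv (by simpa using hy)
  rw [_root_.chartField, this]

variable [IsManifold (𝓡 n) ∞ M] {F : Type*} [NormedAddCommGroup F] [NormedSpace ℝ F]

lemma ContDiffAt.contMDiffAt_comp_chart {h : EuclideanSpace ℝ (Fin n) → F} {x₀ y : M}
    (hh : ContDiffAt ℝ ∞ h (extChartAt (𝓡 n) x₀ y))
    (hy : y ∈ (chartAt (EuclideanSpace ℝ (Fin n)) x₀).source) :
    ContMDiffAt (𝓡 n) 𝓘(ℝ, F) ∞ (fun z ↦ h (extChartAt (𝓡 n) x₀ z)) y :=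
  hh.contMDiffAt.comp y (contMDiffAt_extChartAt' hy)

lemma DiffFieldAt.chartField {X : VField n M} {x₀ y : M} (hX : DiffFieldAt X y)
    (hy : y ∈ (chartAt (EuclideanSpace ℝ (Fin n)) x₀).source) :
    DifferentiableAt ℝ (chartField x₀ X) (extChartAt (𝓡 n) x₀ y) :=
  mdifferentiableAt_chart_symm hy ((diffFieldAt_iff hy).1 hX)

lemma SmoothFieldAt.chartField {X : VField n M} {x₀ y : M} (hX : SmoothFieldAt X y)
    (hy : y ∈ (chartAt (EuclideanSpace ℝ (Fin n)) x₀).source) :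
    ContDiffAt ℝ ∞ (chartField x₀ X) (extChartAt (𝓡 n) x₀ y) :=
  (contMDiffAt_iff_contDiffAt_chart hy).1 ((smoothFieldAt_iff hy).1 hX)

lemma eventually_mvfderiv_apply_eq {h : M → F} {x₀ x : M}
    (hx : x ∈ (chartAt (EuclideanSpace ℝ (Fin n)) x₀).source)
    (hh : ContMDiffAt (𝓡 n) 𝓘(ℝ, F) ∞ h x) (V : VField n M) :
    (fun y ↦ mvfderiv (𝓡 n) h y (V y)) =ᶠ[𝓝 x] fun y ↦
      (fun z ↦ fderiv ℝ (h ∘ (extChartAt (𝓡 n) x₀).symm) z (chartField x₀ V z))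
        (extChartAt (𝓡 n) x₀ y) := by
  have h1 : ∀ᶠ y in 𝓝 x, ContMDiffAt (𝓡 n) 𝓘(ℝ, F) 1 h y :=
    (contMDiffAt_iff_contMDiffAt_nhds (by simp)).1 (hh.of_le (by exact_mod_cast le_top))
  filter_upwards [h1, (chartAt (EuclideanSpace ℝ (Fin n)) x₀).open_source.mem_nhds hx] with y hy hs
  rw [chartField_extChartAt V hs]
  exact mvfderiv_eq_fderiv_chart hs
    (((contMDiffAt_iff_contDiffAt_chart hs).1 hy).differentiableAt (by simp)) _

lemma contMDiffAt_mvfderiv_apply {h : M → F} {x : M} {V : VField n M}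
    (hh : ContMDiffAt (𝓡 n) 𝓘(ℝ, F) ∞ h x) (hV : SmoothFieldAt V x) :
    ContMDiffAt (𝓡 n) 𝓘(ℝ, F) ∞ (fun y ↦ mvfderiv (𝓡 n) h y (V y)) x := by
  have hx := mem_chart_source (EuclideanSpace ℝ (Fin n)) x
  refine ContMDiffAt.congr_of_eventuallyEq ?_ (eventually_mvfderiv_apply_eq hx hh V)
  have key : ContDiffAt ℝ ∞ (fun z ↦ fderiv ℝ (h ∘ (extChartAt (𝓡 n) x).symm) z (chartField x V z))
      (extChartAt (𝓡 n) x x) :=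
    (((contMDiffAt_iff_contDiffAt_chart hx).1 hh).fderiv_right (m := ∞) (by simp)).clm_apply
      (hV.chartField hx)
  exact key.contMDiffAt_comp_chart hx

lemma mlieBracket_eq_lieBracket_chart (V W : VField n M) (x : M) :
    chartDeriv n x x (VectorField.mlieBracket (𝓡 n) V W x)
      = VectorField.lieBracket ℝ (chartField x V) (chartField x W) (extChartAt (𝓡 n) x x) := by
  have key : ∀ V : VField n M, VectorField.mpullbackWithin 𝓘(ℝ, EuclideanSpace ℝ (Fin n)) (𝓡 n)
      (extChartAt (𝓡 n) x).symm V (range (𝓡 n)) =ᶠ[𝓝 (extChartAt (𝓡 n) x x)] chartField x V := by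
    intro V
    filter_upwards [extChartAt_target_mem_nhds (I := 𝓡 n) x] with z hz
    rw [VectorField.mpullbackWithin_apply]
    have h1 := mfderiv_extChartAt_comp_mfderivWithin_extChartAt_symm (I := 𝓡 n) hz
    have h2 := mfderivWithin_extChartAt_symm_comp_mfderiv_extChartAt (I := 𝓡 n) hz
    rw [ContinuousLinearMap.inverse_eq h2 h1]
    rfl
  have h := (chartDeriv_isInvertible (mem_chart_source (EuclideanSpace ℝ (Fin n)) x)).inverse_apply_eq
    (y := VectorField.lieBracketWithin ℝ
      (VectorField.mpullbackWithin 𝓘(ℝ, EuclideanSpace ℝ (Fin n)) (𝓡 n)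
        (extChartAt (𝓡 n) x).symm V (range (𝓡 n)))
      (VectorField.mpullbackWithin 𝓘(ℝ, EuclideanSpace ℝ (Fin n)) (𝓡 n)
        (extChartAt (𝓡 n) x).symm W (range (𝓡 n)))
      ((extChartAt (𝓡 n) x).symm ⁻¹' univ ∩ range (𝓡 n)) (extChartAt (𝓡 n) x x))
    (x := VectorField.mlieBracket (𝓡 n) V W x)
  rw [← h.1 rfl]
  have e : (extChartAt (𝓡 n) x).symm ⁻¹' univ ∩ range (𝓡 n) = univ := by simp
  rw [e, ← (key V).lieBracket_vectorField_eq (key W)]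
  exact congrFun VectorField.lieBracketWithin_univ _

/-- The bracket acts on vector valued functions as the commutator of the derivations. -/
theorem mvfderiv_mlieBracket {h : M → F} {x : M} {V W : VField n M}
    (hh : ContMDiffAt (𝓡 n) 𝓘(ℝ, F) ∞ h x) (hV : DiffFieldAt V x) (hW : DiffFieldAt W x) :
    mvfderiv (𝓡 n) h x (VectorField.mlieBracket (𝓡 n) V W x)
      = mvfderiv (𝓡 n) (fun y ↦ mvfderiv (𝓡 n) h y (W y)) x (V x)
        - mvfderiv (𝓡 n) (fun y ↦ mvfderiv (𝓡 n) h y (V y)) x (W x) := by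
  have hx := mem_chart_source (EuclideanSpace ℝ (Fin n)) x
  have hh' := (contMDiffAt_iff_contDiffAt_chart hx).1 hh
  have hd : DifferentiableAt ℝ (fderiv ℝ (h ∘ (extChartAt (𝓡 n) x).symm)) (extChartAt (𝓡 n) x x) :=
    (hh'.fderiv_right (m := ∞) (by simp)).differentiableAt (by simp)
  have h2 : ContDiffAt ℝ 2 (h ∘ (extChartAt (𝓡 n) x).symm) (extChartAt (𝓡 n) x x) :=
    hh'.of_le (WithTop.coe_le_coe.2 le_top)
  rw [mvfderiv_congr (eventually_mvfderiv_apply_eq hx hh V),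
    mvfderiv_congr (eventually_mvfderiv_apply_eq hx hh W),
    mvfderiv_chart_comp hx (hd.clm_apply (hV.chartField hx)),
    mvfderiv_chart_comp hx (hd.clm_apply (hW.chartField hx)),
    mvfderiv_eq_fderiv_chart hx (hh'.differentiableAt (by simp)),
    mlieBracket_eq_lieBracket_chart,
    VectorField.fderiv_apply_lieBracket_of_isSymmSndFDerivAt h2
      (h2.isSymmSndFDerivAt (by simp)) (hW.chartField hx) (hV.chartField hx),
    chartField_extChartAt V hx, chartField_extChartAt W hx]

/-- A field is smooth if an injective differential maps it to a smooth function. -/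
theorem smoothFieldAt_of_mvfderiv [FiniteDimensional ℝ F] {h : M → F} {x : M} {V : VField n M}
    (hh : ContMDiffAt (𝓡 n) 𝓘(ℝ, F) ∞ h x) (hinj : Function.Injective (mvfderiv (𝓡 n) h x))
    (hV : ContMDiffAt (𝓡 n) 𝓘(ℝ, F) ∞ (fun y ↦ mvfderiv (𝓡 n) h y (V y)) x) :
    SmoothFieldAt V x := by
  have hx := mem_chart_source (EuclideanSpace ℝ (Fin n)) x
  have hh' := (contMDiffAt_iff_contDiffAt_chart hx).1 hh
  set g := h ∘ (extChartAt (𝓡 n) x).symm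
  have hdx : ∀ v, mvfderiv (𝓡 n) h x v
      = fderiv ℝ g (extChartAt (𝓡 n) x x) (chartDeriv n x x v) := fun v ↦
    mvfderiv_eq_fderiv_chart hx (hh'.differentiableAt (by simp)) v
  have hginj : Function.Injective (fderiv ℝ g (extChartAt (𝓡 n) x x)) := by
    intro a b hab
    obtain ⟨v, rfl⟩ := chartDeriv_surjective hx a
    obtain ⟨w, rfl⟩ := chartDeriv_surjective hx b
    rw [← hdx, ← hdx] at hab
    rw [hinj hab]
  obtain ⟨L, hL⟩ := LinearMap.exists_leftInverse_of_injective
    (fderiv ℝ g (extChartAt (𝓡 n) x x)).toLinearMap (LinearMap.ker_eq_bot.2 hginj)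
  let L' : F →L[ℝ] EuclideanSpace ℝ (Fin n) := LinearMap.toContinuousLinearMap L
  let Q : EuclideanSpace ℝ (Fin n) → EuclideanSpace ℝ (Fin n) →L[ℝ] EuclideanSpace ℝ (Fin n) :=
    fun z ↦ L' ∘L fderiv ℝ g z
  have hQ : ContDiffAt ℝ ∞ Q (extChartAt (𝓡 n) x x) :=
    contDiffAt_const.clm_comp (hh'.fderiv_right (m := ∞) (by simp))
  have hQx : Q (extChartAt (𝓡 n) x x) = .id ℝ _ := by
    ext1 a
    exact congrArg (fun K : EuclideanSpace ℝ (Fin n) →ₗ[ℝ] EuclideanSpace ℝ (Fin n) ↦ K a) hL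
  have hinv : ContDiffAt ℝ ∞ (fun z ↦ (Q z).inverse) (extChartAt (𝓡 n) x x) := by
    have h1 : ContDiffAt ℝ ∞ ContinuousLinearMap.inverse (Q (extChartAt (𝓡 n) x x)) := by
      rw [hQx]
      exact contDiffAt_map_inverse (ContinuousLinearEquiv.refl ℝ (EuclideanSpace ℝ (Fin n)))
    exact h1.comp _ hQ
  have hunit : ∀ᶠ z in 𝓝 (extChartAt (𝓡 n) x x), (Q z).IsInvertible := by
    refine hQ.continuousAt.eventually ?_
    have := ContinuousLinearEquiv.nhds (ContinuousLinearEquiv.refl ℝ (EuclideanSpace ℝ (Fin n)))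
    rw [hQx]
    filter_upwards [this] with A hA
    exact hA
  rw [smoothFieldAt_iff hx]
  have e := eventually_mvfderiv_apply_eq hx hh V
  have hs := (contMDiffAt_extChartAt (I := 𝓡 n) (n := ∞) (x := x)).continuousAt.eventually hunit
  refine ContMDiffAt.congr_of_eventuallyEq (f := fun y ↦ (Q (extChartAt (𝓡 n) x y)).inverse
      (L' (mvfderiv (𝓡 n) h y (V y)))) ?_ ?_
  · exact ContMDiffAt.clm_apply (hinv.contMDiffAt_comp_chart hx)
      (L'.contMDiff.contMDiffAt.comp x hV)
  · filter_upwards [e, hs, (chartAt (EuclideanSpace ℝ (Fin n)) x).open_source.mem_nhds hx]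
      with y hy hs hys
    rw [hy]
    simp only [chartField_extChartAt V hys]
    exact (hs.inverse_apply_eq.2 rfl).symm

end FieldDerivations

/-! ### The Leibniz rule along a map -/

section CovariantDerivativeAlong

variable {n : ℕ} {M : Type*} [TopologicalSpace M]
  [ChartedSpace (EuclideanSpace ℝ (Fin n)) M]
  {F : Type*} [NormedAddCommGroup F] [NormedSpace ℝ F]

lemma mvfderiv_clm_comp {G : Type*} [NormedAddCommGroup G] [NormedSpace ℝ G] {f : M → F} {x : M}
    (L : F →L[ℝ] G) (hf : MDifferentiableAt (𝓡 n) 𝓘(ℝ, F) f x) (v : TangentSpace (𝓡 n) x) :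
    mvfderiv (𝓡 n) (fun z ↦ L (f z)) x v = L (mvfderiv (𝓡 n) f x v) := by
  have h := mfderiv_comp_apply x (L.differentiableAt (x := f x)).mdifferentiableAt hf v
  rw [mfderiv_eq_fderiv, L.fderiv] at h
  exact h

lemma mvfderiv_finset_sum {κ : Type*} (s : Finset κ) {f : κ → M → F} {x : M}
    (hf : ∀ i, MDifferentiableAt (𝓡 n) 𝓘(ℝ, F) (f i) x) (v : TangentSpace (𝓡 n) x) :
    MDifferentiableAt (𝓡 n) 𝓘(ℝ, F) (fun z ↦ ∑ i ∈ s, f i z) x ∧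
    mvfderiv (𝓡 n) (fun z ↦ ∑ i ∈ s, f i z) x v = ∑ i ∈ s, mvfderiv (𝓡 n) (f i) x v := by
  classical
  induction s using Finset.induction_on with
  | empty => simpa [mvfderiv_const] using mdifferentiableAt_const
  | insert a s ha ih =>
    simp only [Finset.sum_insert ha]
    refine ⟨(hf a).add ih.1, ?_⟩
    rw [mvfderiv_fun_add (hf a) ih.1, add_apply, ih.2]

lemma mvfderiv_pi_apply {p : ℕ} {f : M → Fin p → ℝ} {x : M}
    (hf : MDifferentiableAt (𝓡 n) 𝓘(ℝ, Fin p → ℝ) f x) (v : TangentSpace (𝓡 n) x) (i : Fin p) :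
    MDifferentiableAt (𝓡 n) 𝓘(ℝ, ℝ) (fun z ↦ f z i) x ∧
    mvfderiv (𝓡 n) (fun z ↦ f z i) x v = mvfderiv (𝓡 n) f x v i :=
  ⟨(ContinuousLinearMap.proj (R := ℝ) (φ := fun _ : Fin p ↦ ℝ) i).differentiableAt.mdifferentiableAt.comp
    x hf, mvfderiv_clm_comp (ContinuousLinearMap.proj (R := ℝ) (φ := fun _ : Fin p ↦ ℝ) i) hf v⟩

variable [IsManifold (𝓡 n) ∞ M]

/-- In the chart around `x`, a connection differs from the derivative of the coordinates
by a bilinear map. -/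
theorem exists_christoffel (D : AffineConnection n M) (x : M) :
    ∃ Γ : TangentSpace (𝓡 n) x →ₗ[ℝ] TangentSpace (𝓡 n) x →L[ℝ] EuclideanSpace ℝ (Fin n),
      ∀ Y : VField n M, DiffFieldAt Y x → ∀ w, chartDeriv n x x (D Y x w)
        = mvfderiv (𝓡 n) (fun z ↦ chartDeriv n x z (Y z)) x w + Γ (Y x) w := by
  have hx := mem_chart_source (EuclideanSpace ℝ (Fin n)) x
  let Φ : VField n M → (TangentSpace (𝓡 n) x →L[ℝ] EuclideanSpace ℝ (Fin n)) := fun Y ↦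
    chartDeriv n x x ∘L D Y x - mvfderiv (𝓡 n) (fun z ↦ chartDeriv n x z (Y z)) x
  have hΦ : TensorialAt (𝓡 n) (EuclideanSpace ℝ (Fin n)) Φ x := by
    constructor
    · intro f σ hf hσ
      have h1 := D.isCovariantDerivativeOnUniv.leibniz hσ hf (mem_univ x)
      have h2 : (fun z ↦ chartDeriv n x z ((f • σ) z))
          = fun z ↦ f z • chartDeriv n x z (σ z) := by
        ext1 z; simp
      ext1 w
      simp only [Φ, h2]
      rw [mvfderiv_fun_smul hf ((diffFieldAt_iff hx).1 hσ), h1]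
      simp [smul_sub]
    · intro σ σ' hσ hσ'
      have h1 := D.isCovariantDerivativeOnUniv.add hσ hσ' (mem_univ x)
      have h2 : (fun z ↦ chartDeriv n x z ((σ + σ') z))
          = fun z ↦ chartDeriv n x z (σ z) + chartDeriv n x z (σ' z) := by
        ext1 z; simp
      ext1 w
      simp only [Φ, h2]
      rw [mvfderiv_fun_add ((diffFieldAt_iff hx).1 hσ) ((diffFieldAt_iff hx).1 hσ'), h1]
      simp
      abel
  refine ⟨(TensorialAt.mkHom Φ x hΦ).toLinearMap, fun Y hY w ↦ ?_⟩
  have h := TensorialAt.mkHom_apply hΦ hY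
  have h2 := congrArg (fun L : TangentSpace (𝓡 n) x →L[ℝ] EuclideanSpace ℝ (Fin n) ↦ L w) h
  change _ = _ + (TensorialAt.mkHom Φ x hΦ (Y x)) w
  rw [h]
  simp

/-- The Leibniz rule for the derivative, along a map `ι`, of a field that is along `ι` a
combination of other fields. -/
theorem covariantDerivative_along {m p : ℕ} {N : Type*} [TopologicalSpace N]
    [ChartedSpace (EuclideanSpace ℝ (Fin m)) N] (D : AffineConnection n M) {ι : N → M} {y : N}
    (hι : MDifferentiableAt (𝓡 m) (𝓡 n) ι y) {Y : VField n M} (hY : DiffFieldAt Y (ι y))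
    {X : Fin p → VField n M} (hX : ∀ i, DiffFieldAt (X i) (ι y)) {f : N → Fin p → ℝ}
    (hf : MDifferentiableAt (𝓡 m) 𝓘(ℝ, Fin p → ℝ) f y)
    (h : ∀ᶠ z in 𝓝 y, Y (ι z) = ∑ i, f z i • X i (ι z)) (v : TangentSpace (𝓡 m) y) :
    D Y (ι y) (mfderiv (𝓡 m) (𝓡 n) ι y v)
      = ∑ i, (mvfderiv (𝓡 m) f y v i • X i (ι y)
        + f y i • D (X i) (ι y) (mfderiv (𝓡 m) (𝓡 n) ι y v)) := by
  have hx := mem_chart_source (EuclideanSpace ℝ (Fin n)) (ι y)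
  obtain ⟨Γ, hΓ⟩ := exists_christoffel D (ι y)
  have hXd := fun i ↦ (diffFieldAt_iff hx).1 (hX i)
  have hXc : ∀ i, MDifferentiableAt (𝓡 m) 𝓘(ℝ, EuclideanSpace ℝ (Fin n))
      (fun z ↦ chartDeriv n (ι y) (ι z) (X i (ι z))) y := fun i ↦ (hXd i).comp y hι
  have hfd := fun i ↦ mvfderiv_pi_apply hf v i
  have e : (fun z ↦ chartDeriv n (ι y) (ι z) (Y (ι z)))
      =ᶠ[𝓝 y] fun z ↦ ∑ i, f z i • chartDeriv n (ι y) (ι z) (X i (ι z)) := by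
    filter_upwards [h] with z hz
    rw [hz, map_sum]
    simp
  refine chartDeriv_injective hx ?_
  rw [hΓ Y hY, ← mvfderiv_comp_mfderiv ((diffFieldAt_iff hx).1 hY) hι, mvfderiv_congr e,
    (mvfderiv_finset_sum (f := fun i z ↦ f z i • chartDeriv n (ι y) (ι z) (X i (ι z))) Finset.univ
      (fun i ↦ (hfd i).1.smul (hXc i)) v).2, h.self_of_nhds, map_sum,
    map_sum, sum_apply, ← Finset.sum_add_distrib]
  refine Finset.sum_congr rfl fun i _ ↦ ?_
  rw [map_add, map_smul, map_smul, map_smul, hΓ (X i) (hX i),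
    ← mvfderiv_comp_mfderiv (hXd i) hι]
  have := mvfderiv_fun_smul (I := 𝓡 m) (hfd i).1 (hXc i)
  rw [this]
  simp [(hfd i).2]
  module

end CovariantDerivativeAlong

/-! ### Local frames and curvature -/

section Frames

variable {n p : ℕ} {M : Type*} [TopologicalSpace M]
  [ChartedSpace (EuclideanSpace ℝ (Fin n)) M] [IsManifold (𝓡 n) ∞ M]

lemma SmoothFieldAt.sum_smul {X : Fin p → VField n M} {f : M → Fin p → ℝ} {x : M}
    (hf : ContMDiffAt (𝓡 n) 𝓘(ℝ, Fin p → ℝ) ∞ f x) (hX : ∀ i, SmoothFieldAt (X i) x) :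
    SmoothFieldAt (fun y ↦ ∑ i, f y i • X i y) x :=
  ContMDiffAt.sum_section fun i _ ↦ ContMDiffAt.smul_section (f := fun y ↦ f y i)
    ((ContinuousLinearMap.proj (R := ℝ) (φ := fun _ : Fin p ↦ ℝ) i).contMDiff.contMDiffAt.comp x hf)
    (hX i)

lemma DiffFieldAt.sum_smul {X : Fin p → VField n M} {f : M → Fin p → ℝ} {x : M}
    (hf : MDifferentiableAt (𝓡 n) 𝓘(ℝ, Fin p → ℝ) f x) (hX : ∀ i, DiffFieldAt (X i) x) :
    DiffFieldAt (fun y ↦ ∑ i, f y i • X i y) x :=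
  MDifferentiableAt.sum_section fun i _ ↦ MDifferentiableAt.smul_section (f := fun y ↦ f y i)
    (mvfderiv_pi_apply hf 0 i).1 (hX i)

/-- Near a point where the fields `X i` are independent, their coefficients in a combination are
read off from a fixed linear image of the chart coordinates, up to a smooth family of linear
maps. -/
theorem exists_coframe_chart {X : Fin p → VField n M} {x : M}
    (hX : ∀ i, ∀ᶠ y in 𝓝 x, SmoothFieldAt (X i) y)
    (hli : LinearIndependent ℝ fun i ↦ X i x) :
    ∃ (L : EuclideanSpace ℝ (Fin n) →L[ℝ] (Fin p → ℝ))
      (c : M → (Fin p → ℝ) →L[ℝ] (Fin p → ℝ)), ∀ᶠ y in 𝓝 x,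
        y ∈ (chartAt (EuclideanSpace ℝ (Fin n)) x).source ∧
        ContMDiffAt (𝓡 n) 𝓘(ℝ, (Fin p → ℝ) →L[ℝ] (Fin p → ℝ)) ∞ c y ∧
        (∀ a, c y (L (chartDeriv n x y (∑ i, a i • X i y))) = a) ∧
        ∀ a, L (chartDeriv n x y (∑ i, c y a i • X i y)) = a := by
  have hx := mem_chart_source (EuclideanSpace ℝ (Fin n)) x
  let S (i : Fin p) : EuclideanSpace ℝ (Fin n) →L[ℝ] (Fin p → ℝ) →L[ℝ] EuclideanSpace ℝ (Fin n) :=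
    ContinuousLinearMap.smulRightL ℝ (Fin p → ℝ) (EuclideanSpace ℝ (Fin n))
      (ContinuousLinearMap.proj (R := ℝ) (φ := fun _ : Fin p ↦ ℝ) i)
  let A : M → (Fin p → ℝ) →L[ℝ] EuclideanSpace ℝ (Fin n) :=
    fun y ↦ ∑ i, S i (chartDeriv n x y (X i y))
  have hA : ∀ y a, A y a = chartDeriv n x y (∑ i, a i • X i y) := by
    intro y a
    simp [A, S, sum_apply]
  have hinj : Function.Injective (A x) := by
    rw [injective_iff_map_eq_zero]
    intro a ha
    rw [hA] at ha
    have h0 := (map_eq_zero_iff _ (chartDeriv_injective hx)).1 ha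
    exact funext (Fintype.linearIndependent_iff.1 hli a h0)
  obtain ⟨L₀, hL₀⟩ := LinearMap.exists_leftInverse_of_injective (A x).toLinearMap
    (LinearMap.ker_eq_bot.2 hinj)
  let L : EuclideanSpace ℝ (Fin n) →L[ℝ] (Fin p → ℝ) := LinearMap.toContinuousLinearMap L₀
  let Q : M → (Fin p → ℝ) →L[ℝ] (Fin p → ℝ) := fun y ↦ L ∘L A y
  have hQx : Q x = .id ℝ _ := by
    ext1 a
    exact congrArg (fun K : (Fin p → ℝ) →ₗ[ℝ] (Fin p → ℝ) ↦ K a) hL₀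
  have hQs : ∀ᶠ y in 𝓝 x, ContMDiffAt (𝓡 n) 𝓘(ℝ, (Fin p → ℝ) →L[ℝ] (Fin p → ℝ)) ∞ Q y := by
    filter_upwards [Filter.eventually_all.2 hX,
      (chartAt (EuclideanSpace ℝ (Fin n)) x).open_source.mem_nhds hx] with y hy hys
    have hAy : ContMDiffAt (𝓡 n) 𝓘(ℝ, (Fin p → ℝ) →L[ℝ] EuclideanSpace ℝ (Fin n)) ∞ A y :=
      contMDiffAt_finsetSum fun i _ ↦
        (S i).contMDiff.contMDiffAt.comp y ((smoothFieldAt_iff hys).1 (hy i))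
    exact ContMDiffAt.clm_comp contMDiffAt_const hAy
  have hunit : ∀ᶠ y in 𝓝 x, (Q y).IsInvertible := by
    refine hQs.self_of_nhds.continuousAt.eventually ?_
    have := ContinuousLinearEquiv.nhds (ContinuousLinearEquiv.refl ℝ (Fin p → ℝ))
    rw [hQx]
    filter_upwards [this] with A hA
    exact hA
  refine ⟨L, fun y ↦ (Q y).inverse, ?_⟩
  filter_upwards [hQs, hunit, (chartAt (EuclideanSpace ℝ (Fin n)) x).open_source.mem_nhds hx]
    with y hy1 hy2 hy3
  refine ⟨hy3, ?_, fun a ↦ ?_, fun a ↦ ?_⟩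
  · have h1 : ContDiffAt ℝ ∞ ContinuousLinearMap.inverse (Q y) := by
      obtain ⟨e, he⟩ := hy2
      rw [← he]
      exact contDiffAt_map_inverse e
    exact h1.contMDiffAt.comp y hy1
  · rw [← hA]
    exact hy2.inverse_apply_eq.2 rfl
  · rw [← hA]
    exact (hy2.inverse_apply_eq.1 rfl).symm

/-- Near a point where the fields `X i` are independent, there are one-forms dual to them,
and these are smooth. -/
theorem exists_coframe {X : Fin p → VField n M} {x : M}
    (hX : ∀ i, ∀ᶠ y in 𝓝 x, SmoothFieldAt (X i) y)
    (hli : LinearIndependent ℝ fun i ↦ X i x) :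
    ∃ θ : Π y : M, TangentSpace (𝓡 n) y →L[ℝ] (Fin p → ℝ), ∀ᶠ y in 𝓝 x,
      (∀ a, θ y (∑ i, a i • X i y) = a) ∧
      (∀ Z : VField n M, SmoothFieldAt Z y →
        ContMDiffAt (𝓡 n) 𝓘(ℝ, Fin p → ℝ) ∞ (fun z ↦ θ z (Z z)) y) ∧
      ∀ Z : VField n M, DiffFieldAt Z y →
        MDifferentiableAt (𝓡 n) 𝓘(ℝ, Fin p → ℝ) (fun z ↦ θ z (Z z)) y := by
  obtain ⟨L, c, h⟩ := exists_coframe_chart hX hli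
  refine ⟨fun y ↦ c y ∘L L ∘L chartDeriv n x y, ?_⟩
  filter_upwards [h] with y ⟨hy, hc, hca, _⟩
  refine ⟨hca, fun Z hZ ↦ ?_, fun Z hZ ↦ ?_⟩
  · exact hc.clm_apply (L.contMDiff.contMDiffAt.comp y ((smoothFieldAt_iff hy).1 hZ))
  · exact (hc.mdifferentiableAt (by simp)).clm_apply
      (L.differentiableAt.mdifferentiableAt.comp y ((diffFieldAt_iff hy).1 hZ))

end Frames

section Curvature

variable {n p : ℕ} {M : Type*} [TopologicalSpace M]
  [ChartedSpace (EuclideanSpace ℝ (Fin n)) M] [IsManifold (𝓡 n) ∞ M]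

lemma AffineConnection.congr_of_eventuallyEq (D : AffineConnection n M) {X X' : VField n M} {x : M}
    (hX : DiffFieldAt X x) (h : ∀ᶠ y in 𝓝 x, X y = X' y) : D X x = D X' x := by
  refine D.isCovariantDerivativeOnUniv.congr_of_eventuallyEq hX ?_ Filter.univ_mem h
  refine MDifferentiableAt.congr_of_eventuallyEq hX ?_
  filter_upwards [h] with y hy
  rw [hy]

/-- The covariant derivative of a smooth field along a smooth field is smooth. -/
theorem SmoothFieldOn.covField {M : Type u} [TopologicalSpace M] [T2Space M]
    [ChartedSpace (EuclideanSpace ℝ (Fin n)) M] [IsManifold (𝓡 n) ∞ M] {D : AffineConnection n M}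
    (hD : D.ContMDiffCovariantDerivative ∞) {U : Set M} (hU : IsOpen U) {X Y : VField n M}
    (hX : SmoothFieldOn X U) (hY : SmoothFieldOn Y U) : SmoothFieldOn (covField D Y X) U := by
  intro x hx
  obtain ⟨ψ, -, hψ⟩ := (SmoothBumpFunction.nhds_basis_tsupport (I := 𝓡 n) x).mem_iff.1
    (hU.mem_nhds hx)
  have h1 : ContMDiff (𝓡 n) (𝓡 n).tangent ∞
      (fun y ↦ (⟨y, ((ψ : M → ℝ) • X) y⟩ : TangentBundle (𝓡 n) M)) :=
    ContMDiffOn.smul_section_of_tsupport ψ.contMDiff.contMDiffOn hU hψ hX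
  have h2 := hD.contMDiff.contMDiff (σ := (ψ : M → ℝ) • X) (by simpa using h1.contMDiffOn)
  have h3 : SmoothFieldAt (fun y ↦ D ((ψ : M → ℝ) • X) y (Y y)) x :=
    ContMDiffAt.clm_bundle_apply ((h2 x (mem_univ x)).contMDiffAt Filter.univ_mem)
      (hY.smoothFieldAt hU hx)
  refine ContMDiffAt.contMDiffWithinAt (h3.congr_of_eventuallyEq ?_)
  filter_upwards [ψ.eventuallyEq_one.eventually_nhds, hU.mem_nhds hx] with y hy hyU
  have := D.congr_of_eventuallyEq (hX.smoothFieldAt hU hyU).diffFieldAt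
    (X' := (ψ : M → ℝ) • X) (by
      filter_upwards [hy] with z hz
      simp [hz])
  simp only [_root_.covField, this]

/-- The curvature annihilates the combinations of fields that are parallel in the directions
under consideration. -/
theorem riemannCurvature_eq_zero_of_parallel (D : AffineConnection n M) {x : M}
    {Y Z W : VField n M} {X : Fin p → VField n M} {f : M → Fin p → ℝ}
    (hX : ∀ i, ∀ᶠ y in 𝓝 x, SmoothFieldAt (X i) y)
    (hf : ∀ᶠ y in 𝓝 x, ContMDiffAt (𝓡 n) 𝓘(ℝ, Fin p → ℝ) ∞ f y)
    (hW : ∀ᶠ y in 𝓝 x, W y = ∑ i, f y i • X i y)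
    (hY : SmoothFieldAt Y x) (hZ : SmoothFieldAt Z x)
    (hXY : ∀ i, ∀ᶠ y in 𝓝 x, D (X i) y (Y y) = 0) (hXZ : ∀ i, ∀ᶠ y in 𝓝 x, D (X i) y (Z y) = 0)
    (hXb : ∀ i, D (X i) x (VectorField.mlieBracket (𝓡 n) Y Z x) = 0) :
    riemannCurvature D Y Z W x = 0 := by
  have hX' := Filter.eventually_all.2 hX
  have hcov : ∀ᶠ y in 𝓝 x, ∀ v, D W y v
      = ∑ i, (mvfderiv (𝓡 n) f y v i • X i y + f y i • D (X i) y v) := by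
    filter_upwards [hX', hf, hW.eventually_nhds] with y hX hf hW v
    have hWd : DiffFieldAt W y :=
      (DiffFieldAt.sum_smul (hf.mdifferentiableAt (by simp))
        fun i ↦ (hX i).diffFieldAt).congr_of_eventuallyEq (by
          filter_upwards [hW] with z hz
          rw [hz])
    have := covariantDerivative_along D (ι := id) mdifferentiableAt_id hWd
      (fun i ↦ (hX i).diffFieldAt) (hf.mdifferentiableAt (by simp)) hW v
    simpa using this
  have key : ∀ V V' : VField n M, SmoothFieldAt V x →
      (∀ i, ∀ᶠ y in 𝓝 x, D (X i) y (V y) = 0) → (∀ i, D (X i) x (V' x) = 0) →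
      covField D V' (covField D V W) x
        = ∑ i, mvfderiv (𝓡 n) (fun y ↦ mvfderiv (𝓡 n) f y (V y)) x (V' x) i • X i x := by
    intro V V' hV hXV hXV'
    have e : ∀ᶠ y in 𝓝 x, covField D V W y = ∑ i, mvfderiv (𝓡 n) f y (V y) i • X i y := by
      filter_upwards [hcov, Filter.eventually_all.2 hXV] with y hy hXV
      simp [covField, hy, hXV]
    have hfd := (contMDiffAt_mvfderiv_apply hf.self_of_nhds hV).mdifferentiableAt (by simp)
    have hd : DiffFieldAt (covField D V W) x :=
      (DiffFieldAt.sum_smul hfd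
        fun i ↦ (hX i).self_of_nhds.diffFieldAt).congr_of_eventuallyEq (by
          filter_upwards [e] with z hz
          rw [hz])
    have := covariantDerivative_along D (ι := id) mdifferentiableAt_id hd
      (fun i ↦ (hX i).self_of_nhds.diffFieldAt) hfd e (V' x)
    simp only [id_eq, mfderiv_id, ContinuousLinearMap.id_apply, hXV', smul_zero, add_zero] at this
    exact this
  have hbr := mvfderiv_mlieBracket hf.self_of_nhds hY.diffFieldAt hZ.diffFieldAt
  have h1 := key Z Y hZ hXZ fun i ↦ (hXY i).self_of_nhds
  have h2 := key Y Z hY hXY fun i ↦ (hXZ i).self_of_nhds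
  simp only [riemannCurvature, Pi.sub_apply, h1, h2]
  rw [covField, hcov.self_of_nhds, hbr]
  simp [hXb, sub_smul, Finset.sum_sub_distrib]

end Curvature

/-! ### Self-stable distributions and their curvature -/

namespace TangentDistribution

section Basis

variable {n p : ℕ} {M : Type u} [TopologicalSpace M]
  [ChartedSpace (EuclideanSpace ℝ (Fin n)) M] [IsManifold (𝓡 n) ∞ M]
  {Ω : TangentDistribution n M p} {D : AffineConnection n M}

lemma _root_.IsBasisOn.exists_eq_sum {S : Π x : M, Submodule ℝ (TangentSpace (𝓡 n) x)}
    {X : Fin p → VField n M} {U : Set M} (hX : IsBasisOn S X U) {y : M} (hy : y ∈ U)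
    {v : TangentSpace (𝓡 n) y} (hv : v ∈ S y) : ∃ a : Fin p → ℝ, ∑ i, a i • X i y = v := by
  rw [← hX.span_eq y hy] at hv
  exact Submodule.mem_span_range_iff_exists_fun ℝ |>.1 hv

lemma _root_.IsBasisOn.sum_mem {S : Π x : M, Submodule ℝ (TangentSpace (𝓡 n) x)}
    {X : Fin p → VField n M} {U : Set M} (hX : IsBasisOn S X U) {y : M} (hy : y ∈ U)
    (a : Fin p → ℝ) : ∑ i, a i • X i y ∈ S y := by
  rw [← hX.span_eq y hy]
  exact Submodule.sum_mem _ fun i _ ↦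
    Submodule.smul_mem _ _ (Submodule.subset_span (mem_range_self i))

lemma _root_.sum_smul_sum_single {κ : (Fin p → ℝ) →L[ℝ] (Fin p → ℝ)} {V : Type*} [AddCommGroup V]
    [Module ℝ V] (X : Fin p → V) (a : Fin p → ℝ) :
    ∑ j, a j • ∑ i, κ (Pi.single j 1) i • X i = ∑ i, κ a i • X i := by
  have ha : κ a = ∑ j, a j • κ (Pi.single j 1) := by
    conv_lhs => rw [pi_eq_sum_univ' a, map_sum]
    simp
  rw [ha]
  simp only [Finset.smul_sum, Finset.sum_apply, Finset.sum_smul, Pi.smul_apply, smul_smul,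
    smul_eq_mul]
  exact Finset.sum_comm

/-- An invertible smooth matrix turns a local basis into a local basis. -/
lemma _root_.IsBasisOn.change {S : Π x : M, Submodule ℝ (TangentSpace (𝓡 n) x)}
    {X : Fin p → VField n M} {U V : Set M} (hX : IsBasisOn S X U) (hU : IsOpen U) (hVU : V ⊆ U)
    {κ : M → (Fin p → ℝ) →L[ℝ] (Fin p → ℝ)}
    (hκ : ∀ y ∈ V, ContMDiffAt (𝓡 n) 𝓘(ℝ, (Fin p → ℝ) →L[ℝ] (Fin p → ℝ)) ∞ κ y)
    (hbij : ∀ y ∈ V, Function.Bijective (κ y)) :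
    IsBasisOn S (fun j y ↦ ∑ i, κ y (Pi.single j 1) i • X i y) V where
  smooth j y hy := (SmoothFieldAt.sum_smul ((hκ y hy).clm_apply contMDiffAt_const)
    fun i ↦ (hX.smooth i).smoothFieldAt hU (hVU hy)).contMDiffWithinAt
  linearIndependent y hy := by
    refine Fintype.linearIndependent_iff.2 fun a ha i ↦ ?_
    rw [sum_smul_sum_single] at ha
    have h0 : κ y a = 0 :=
      funext (Fintype.linearIndependent_iff.1 (hX.linearIndependent y (hVU hy)) _ ha)
    rw [(map_eq_zero_iff _ (hbij y hy).injective).1 h0]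
    rfl
  span_eq y hy := by
    refine le_antisymm (Submodule.span_le.2 ?_) fun v hv ↦ ?_
    · rintro _ ⟨j, rfl⟩
      exact hX.sum_mem (hVU hy) _
    · obtain ⟨b, rfl⟩ := hX.exists_eq_sum (hVU hy) hv
      obtain ⟨a, rfl⟩ := (hbij y hy).surjective b
      rw [← sum_smul_sum_single]
      exact Submodule.sum_mem _ fun i _ ↦
        Submodule.smul_mem _ _ (Submodule.subset_span (mem_range_self i))

lemma _root_.IsBasisOn.isFieldOn {X : Fin p → VField n M} {U : Set M}
    (hX : IsBasisOn Ω.space X U) (hU : IsOpen U) (a : Fin p → ℝ) :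
    Ω.IsFieldOn (fun y ↦ ∑ i, a i • X i y) U where
  smooth _ hy := (SmoothFieldAt.sum_smul (f := fun _ ↦ a) contMDiffAt_const
    fun i ↦ (hX.smooth i).smoothFieldAt hU hy).contMDiffWithinAt
  mem _ hy := hX.sum_mem hy a

/-- The coefficients with respect to a local basis are given by smooth one-forms. -/
lemma _root_.IsBasisOn.exists_coeff {S : Π x : M, Submodule ℝ (TangentSpace (𝓡 n) x)}
    {X : Fin p → VField n M} {U : Set M} (hX : IsBasisOn S X U) (hU : IsOpen U) {x : M}
    (hx : x ∈ U) :
    ∃ θ : Π y : M, TangentSpace (𝓡 n) y →L[ℝ] (Fin p → ℝ), ∀ᶠ y in 𝓝 x,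
      (∀ v ∈ S y, v = ∑ i, θ y v i • X i y) ∧
      (∀ Z : VField n M, SmoothFieldAt Z y →
        ContMDiffAt (𝓡 n) 𝓘(ℝ, Fin p → ℝ) ∞ (fun z ↦ θ z (Z z)) y) ∧
      (∀ Z : VField n M, DiffFieldAt Z y →
        MDifferentiableAt (𝓡 n) 𝓘(ℝ, Fin p → ℝ) (fun z ↦ θ z (Z z)) y) := by
  have hXs : ∀ i, ∀ᶠ y in 𝓝 x, SmoothFieldAt (X i) y := fun i ↦ by
    filter_upwards [hU.mem_nhds hx] with y hy
    exact (hX.smooth i).smoothFieldAt hU hy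
  obtain ⟨θ, hθ⟩ := exists_coframe hXs (hX.linearIndependent x hx)
  refine ⟨θ, ?_⟩
  filter_upwards [hθ, hU.mem_nhds hx] with y ⟨h1, h2, h3⟩ hy
  refine ⟨fun v hv ↦ ?_, h2, h3⟩
  obtain ⟨a, rfl⟩ := hX.exists_eq_sum hy hv
  rw [h1]

/-- The basis in the definition of regular self-stability is annihilated by the covariant
derivative in every direction of the distribution. -/
lemma IsRegularlySelfStable.exists_parallel_basis (h : Ω.IsRegularlySelfStable D) (x : M) :
    ∃ U : Set M, IsOpen U ∧ x ∈ U ∧ ∃ X : Fin p → VField n M, IsBasisOn Ω.space X U ∧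
      ∀ y ∈ U, ∀ v ∈ Ω.space y, ∀ i, D (X i) y v = 0 := by
  obtain ⟨U, hU, hx, X, hX, hpar⟩ := h x
  refine ⟨U, hU, hx, X, hX, fun y hy v hv i ↦ ?_⟩
  obtain ⟨a, rfl⟩ := hX.exists_eq_sum hy hv
  exact hpar _ (hX.isFieldOn hU a) i y hy

theorem IsRegularlySelfStable.isSelfStable (h : Ω.IsRegularlySelfStable D) :
    Ω.IsSelfStable D := by
  intro V hV Y Z hY hZ x hx
  obtain ⟨U, hU, hxU, X, hX, hpar⟩ := h.exists_parallel_basis x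
  obtain ⟨θ, hθ⟩ := hX.exists_coeff hU hxU
  have hY' := hY.smooth.smoothFieldAt hV hx
  have e : ∀ᶠ y in 𝓝 x, Y (id y) = ∑ i, θ y (Y y) i • X i (id y) := by
    filter_upwards [hθ, hV.mem_nhds hx] with y hy hyV
    exact hy.1 _ (hY.mem y hyV)
  have := covariantDerivative_along D (ι := id) mdifferentiableAt_id hY'.diffFieldAt
    (fun i ↦ ((hX.smooth i).smoothFieldAt hU hxU).diffFieldAt)
    ((hθ.self_of_nhds.2.1 Y hY').mdifferentiableAt (by simp)) e (Z x)
  have hz := fun i ↦ hpar x hxU (Z x) (hZ.mem x hx) i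
  simp only [id_eq, mfderiv_id, ContinuousLinearMap.id_apply, hz, smul_zero, add_zero] at this
  rw [covField, this]
  exact hX.sum_mem hxU _

lemma _root_.mlieBracket_eq_of_torsion_eq_zero (hD : D.torsion = 0) {X Y : VField n M} {x : M}
    (hX : DiffFieldAt X x) (hY : DiffFieldAt Y x) :
    VectorField.mlieBracket (𝓡 n) X Y x = D Y x (X x) - D X x (Y x) :=
  (D.torsion_eq_zero_iff.1 hD hX hY).symm

lemma IsSelfStable.mlieBracket_mem (h : Ω.IsSelfStable D) (hD : D.torsion = 0) {U : Set M}
    (hU : IsOpen U) {X Y : VField n M} (hX : Ω.IsFieldOn X U) (hY : Ω.IsFieldOn Y U) {x : M}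
    (hx : x ∈ U) : VectorField.mlieBracket (𝓡 n) X Y x ∈ Ω.space x := by
  rw [mlieBracket_eq_of_torsion_eq_zero hD (hX.smooth.smoothFieldAt hU hx).diffFieldAt
    (hY.smooth.smoothFieldAt hU hx).diffFieldAt]
  exact Submodule.sub_mem _ (h U hU Y X hY hX x hx) (h U hU X Y hX hY x hx)

theorem IsRegularlySelfStable.curvatureVanishesOn (h : Ω.IsRegularlySelfStable D)
    (hD : D.torsion = 0) : Ω.CurvatureVanishesOn D := by
  intro V hV W Y Z hW hY hZ x hx
  obtain ⟨U, hU, hxU, X, hX, hpar⟩ := h.exists_parallel_basis x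
  obtain ⟨θ, hθ⟩ := hX.exists_coeff hU hxU
  refine riemannCurvature_eq_zero_of_parallel D (X := X) (f := fun y ↦ θ y (W y)) (fun i ↦ ?_) ?_ ?_
    (hY.smooth.smoothFieldAt hV hx) (hZ.smooth.smoothFieldAt hV hx) (fun i ↦ ?_) (fun i ↦ ?_)
    fun i ↦ hpar x hxU _ (h.isSelfStable.mlieBracket_mem hD hV hY hZ hx) i
  · filter_upwards [hU.mem_nhds hxU] with y hy
    exact (hX.smooth i).smoothFieldAt hU hy
  · filter_upwards [hθ, hV.mem_nhds hx] with y hy hyV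
    exact hy.2.1 W (hW.smooth.smoothFieldAt hV hyV)
  · filter_upwards [hθ, hV.mem_nhds hx] with y hy hyV
    exact hy.1 _ (hW.mem y hyV)
  · filter_upwards [hU.mem_nhds hxU, hV.mem_nhds hx] with y hy hyV
    exact hpar y hy _ (hY.mem y hyV) i
  · filter_upwards [hU.mem_nhds hxU, hV.mem_nhds hx] with y hy hyV
    exact hpar y hy _ (hZ.mem y hyV) i

end Basis

section AdaptedFrame

variable {n p : ℕ} {M : Type u} [TopologicalSpace M]
  [ChartedSpace (EuclideanSpace ℝ (Fin n)) M] [IsManifold (𝓡 n) ∞ M]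

/-- A local basis `B` of `Ω` such that, for some linear image `L` of the coordinates around `x₀`,
the components of a field of `Ω` with respect to `B` are the derivatives of these functions. -/
structure IsAdaptedFrame (Ω : TangentDistribution n M p) (x₀ : M)
    (L : EuclideanSpace ℝ (Fin n) →L[ℝ] (Fin p → ℝ)) (B : Fin p → VField n M) (O : Set M) :
    Prop where
  isOpen : IsOpen O
  subset_source : O ⊆ (chartAt (EuclideanSpace ℝ (Fin n)) x₀).source
  basis : IsBasisOn Ω.space B O
  coord (y : M) (hy : y ∈ O) (a : Fin p → ℝ) : L (chartDeriv n x₀ y (∑ i, a i • B i y)) = a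

/-- Over a neighbourhood of `x₀`, a suitable `p`-dimensional linear image of the coordinates
restricts to an isomorphism on each subspace of `Ω`; the frame is dual to it. -/
theorem exists_isAdaptedFrame (Ω : TangentDistribution n M p) (x₀ : M) :
    ∃ L B O, x₀ ∈ O ∧ Ω.IsAdaptedFrame x₀ L B O := by
  obtain ⟨U, hU, hx, X, hX⟩ := Ω.exists_basis x₀
  have hXs : ∀ i, ∀ᶠ y in 𝓝 x₀, SmoothFieldAt (X i) y := fun i ↦ by
    filter_upwards [hU.mem_nhds hx] with y hy
    exact (hX.smooth i).smoothFieldAt hU hy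
  obtain ⟨L, c, h⟩ := exists_coframe_chart hXs (hX.linearIndependent x₀ hx)
  obtain ⟨O, hO, hOo, hxO⟩ := mem_nhds_iff.1 (h.and (hU.mem_nhds hx))
  refine ⟨L, fun j y ↦ ∑ i, c y (Pi.single j 1) i • X i y, O, hxO, hOo, fun y hy ↦ (hO hy).1.1,
    hX.change hU (fun y hy ↦ (hO hy).2) (fun y hy ↦ (hO hy).1.2.1) fun y hy ↦ ⟨?_, fun a ↦ ?_⟩,
    fun y hy a ↦ ?_⟩
  · exact Function.LeftInverse.injective
      (g := fun b : Fin p → ℝ ↦ L (chartDeriv n x₀ y (∑ i, b i • X i y))) (hO hy).1.2.2.2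
  · exact ⟨_, (hO hy).1.2.2.1 a⟩
  · rw [sum_smul_sum_single]
    exact (hO hy).1.2.2.2 a

end AdaptedFrame

end TangentDistribution

/-! ### The connection in an adapted frame -/

lemma mvfderiv_clm_apply_const {n : ℕ} {M : Type*} [TopologicalSpace M]
    [ChartedSpace (EuclideanSpace ℝ (Fin n)) M] {F₁ F₂ : Type*}
    [NormedAddCommGroup F₁] [NormedSpace ℝ F₁] [NormedAddCommGroup F₂] [NormedSpace ℝ F₂]
    {G : M → F₁ →L[ℝ] F₂} {y : M}
    (hG : MDifferentiableAt (𝓡 n) 𝓘(ℝ, F₁ →L[ℝ] F₂) G y) (f : F₁) :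
    MDifferentiableAt (𝓡 n) 𝓘(ℝ, F₂) (fun z ↦ G z f) y ∧
      ∀ v, mvfderiv (𝓡 n) (fun z ↦ G z f) y v = mvfderiv (𝓡 n) G y v f :=
  ⟨(ContinuousLinearMap.apply ℝ F₂ f).differentiableAt.mdifferentiableAt.comp y hG,
    fun v ↦ mvfderiv_clm_comp (ContinuousLinearMap.apply ℝ F₂ f) hG v⟩

namespace TangentDistribution

section FlatCase

variable {n p : ℕ} {M : Type u} [TopologicalSpace M]
  [ChartedSpace (EuclideanSpace ℝ (Fin n)) M] [IsManifold (𝓡 n) ∞ M]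
  {Ω : TangentDistribution n M p} {D : AffineConnection n M} {x₀ : M}
  {L : EuclideanSpace ℝ (Fin n) →L[ℝ] (Fin p → ℝ)} {B : Fin p → VField n M} {O : Set M}

lemma IsAdaptedFrame.sum_coord (h : Ω.IsAdaptedFrame x₀ L B O) {y : M} (hy : y ∈ O)
    {v : TangentSpace (𝓡 n) y} (hv : v ∈ Ω.space y) :
    ∑ i, L (chartDeriv n x₀ y v) i • B i y = v := by
  obtain ⟨a, rfl⟩ := h.basis.exists_eq_sum hy hv
  rw [h.coord y hy]

lemma IsAdaptedFrame.eq_zero_of_coord (h : Ω.IsAdaptedFrame x₀ L B O) {y : M} (hy : y ∈ O)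
    {v : TangentSpace (𝓡 n) y} (hv : v ∈ Ω.space y) (h0 : L (chartDeriv n x₀ y v) = 0) : v = 0 := by
  rw [← h.sum_coord hy hv, h0]
  simp

/-- The coordinate fields of an adapted frame commute. -/
lemma IsAdaptedFrame.mlieBracket_eq_zero (h : Ω.IsAdaptedFrame x₀ L B O) (hs : Ω.IsSelfStable D)
    (hD : D.torsion = 0) (a b : Fin p → ℝ) {y : M} (hy : y ∈ O) :
    VectorField.mlieBracket (𝓡 n) (fun z ↦ ∑ i, a i • B i z) (fun z ↦ ∑ i, b i • B i z) y = 0 := by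
  have ha := h.basis.isFieldOn h.isOpen a
  have hb := h.basis.isFieldOn h.isOpen b
  have hys := h.subset_source hy
  refine h.eq_zero_of_coord hy (hs.mlieBracket_mem hD h.isOpen ha hb hy) ?_
  let f : M → Fin p → ℝ := fun z ↦ L (extChartAt (𝓡 n) x₀ z)
  have hf : ContMDiffAt (𝓡 n) 𝓘(ℝ, Fin p → ℝ) ∞ f y := L.contDiff.contDiffAt.contMDiffAt_comp_chart hys
  have hdf : ∀ z ∈ O, ∀ v, mvfderiv (𝓡 n) f z v = L (chartDeriv n x₀ z v) := by
    intro z hz v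
    rw [mvfderiv_chart_comp (h.subset_source hz) L.differentiableAt, L.fderiv]
  have hconst : ∀ c : Fin p → ℝ, (fun z ↦ mvfderiv (𝓡 n) f z (∑ i, c i • B i z)) =ᶠ[𝓝 y] fun _ ↦ c := by
    intro c
    filter_upwards [h.isOpen.mem_nhds hy] with z hz
    rw [hdf z hz, h.coord z hz]
  rw [← hdf y hy, mvfderiv_mlieBracket hf (ha.smooth.smoothFieldAt h.isOpen hy).diffFieldAt
    (hb.smooth.smoothFieldAt h.isOpen hy).diffFieldAt, mvfderiv_congr (hconst a),
    mvfderiv_congr (hconst b), mvfderiv_const, mvfderiv_const]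
  simp

/-- The coefficients of the connection in an adapted frame:
`∇_Y X = ∑ l, connCoeff y f a l • B l` if `X = ∑ i, f i • B i` and `Y = ∑ k, a k • B k`, where
`f` and `a` are constant. -/
def connCoeff (D : AffineConnection n M) (x₀ : M)
    (L : EuclideanSpace ℝ (Fin n) →L[ℝ] (Fin p → ℝ)) (B : Fin p → VField n M) (y : M) :
    (Fin p → ℝ) →L[ℝ] (Fin p → ℝ) →L[ℝ] (Fin p → ℝ) :=
  ∑ i, ContinuousLinearMap.smulRightL ℝ (Fin p → ℝ) ((Fin p → ℝ) →L[ℝ] (Fin p → ℝ))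
    (ContinuousLinearMap.proj (R := ℝ) (φ := fun _ : Fin p ↦ ℝ) i)
    (∑ k, ContinuousLinearMap.smulRightL ℝ (Fin p → ℝ) (Fin p → ℝ)
      (ContinuousLinearMap.proj (R := ℝ) (φ := fun _ : Fin p ↦ ℝ) k)
      (L (chartDeriv n x₀ y (D (B i) y (B k y)))))

lemma connCoeff_apply (y : M) (f a : Fin p → ℝ) :
    connCoeff D x₀ L B y f a
      = ∑ i, f i • L (chartDeriv n x₀ y (D (B i) y (∑ k, a k • B k y))) := by
  rw [connCoeff, sum_apply, sum_apply]
  refine Finset.sum_congr rfl fun i _ ↦ ?_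
  change f i • (∑ k, _ : (Fin p → ℝ) →L[ℝ] (Fin p → ℝ)) a = _
  rw [sum_apply, map_sum, map_sum, map_sum]
  congr 1
  refine Finset.sum_congr rfl fun k _ ↦ ?_
  rw [map_smul, map_smul, map_smul]
  rfl

lemma IsAdaptedFrame.contMDiffAt_connCoeff [T2Space M] (h : Ω.IsAdaptedFrame x₀ L B O)
    (hD : D.ContMDiffCovariantDerivative ∞) {y : M} (hy : y ∈ O) :
    ContMDiffAt (𝓡 n) 𝓘(ℝ, (Fin p → ℝ) →L[ℝ] (Fin p → ℝ) →L[ℝ] (Fin p → ℝ)) ∞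
      (connCoeff D x₀ L B) y := by
  refine contMDiffAt_finsetSum fun i _ ↦ ContMDiffAt.comp y
    (ContinuousLinearMap.contMDiff _).contMDiffAt (contMDiffAt_finsetSum fun k _ ↦
      ContMDiffAt.comp y (ContinuousLinearMap.contMDiff _).contMDiffAt
        (L.contMDiff.contMDiffAt.comp y ((smoothFieldAt_iff (h.subset_source hy)).1 ?_)))
  exact (SmoothFieldOn.covField hD h.isOpen (h.basis.smooth i) (h.basis.smooth k)).smoothFieldAt
    h.isOpen hy

/-- The covariant derivative of a field of `Ω` in an adapted frame. -/
lemma IsAdaptedFrame.covariantDerivative_eq (h : Ω.IsAdaptedFrame x₀ L B O)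
    (hs : Ω.IsSelfStable D) {y : M} (hy : y ∈ O) {f : M → Fin p → ℝ}
    (hf : MDifferentiableAt (𝓡 n) 𝓘(ℝ, Fin p → ℝ) f y) {W : VField n M}
    (hW : ∀ᶠ z in 𝓝 y, W z = ∑ i, f z i • B i z) (a : Fin p → ℝ) :
    D W y (∑ k, a k • B k y) = ∑ l, (mvfderiv (𝓡 n) f y (∑ k, a k • B k y)
      + connCoeff D x₀ L B y (f y) a) l • B l y := by
  have hB := fun i ↦ ((h.basis.smooth i).smoothFieldAt h.isOpen hy).diffFieldAt
  have hWd : DiffFieldAt W y := (DiffFieldAt.sum_smul hf hB).congr_of_eventuallyEq (by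
    filter_upwards [hW] with z hz
    rw [hz])
  have h1 := covariantDerivative_along D (ι := id) mdifferentiableAt_id hWd hB hf hW
    (∑ k, a k • B k y)
  simp only [id_eq, mfderiv_id, ContinuousLinearMap.id_apply] at h1
  have h2 : ∀ i, D (B i) y (∑ k, a k • B k y) ∈ Ω.space y := fun i ↦
    hs O h.isOpen _ _ ⟨h.basis.smooth i, fun z hz ↦ h.basis.span_eq z hz ▸
      Submodule.subset_span (mem_range_self i)⟩ (h.basis.isFieldOn h.isOpen a) y hy
  have h3 : ∑ l, connCoeff D x₀ L B y (f y) a l • B l y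
      = ∑ i, f y i • D (B i) y (∑ k, a k • B k y) := by
    rw [connCoeff_apply]
    conv_rhs => enter [2, i]; rw [← h.sum_coord hy (h2 i)]
    simp only [Finset.smul_sum, Finset.sum_apply, Finset.sum_smul, Pi.smul_apply, smul_smul,
      smul_eq_mul]
    exact Finset.sum_comm
  rw [h1, Finset.sum_add_distrib, ← h3, ← Finset.sum_add_distrib]
  exact Finset.sum_congr rfl fun l _ ↦ (add_smul _ _ _).symm

set_option synthInstance.maxHeartbeats 200000 in
/-- The curvature of the fields of `Ω` vanishes only if the connection coefficients satisfy the
integrability condition of the equation for parallel fields. -/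
lemma IsAdaptedFrame.connCoeff_integrable [T2Space M] (h : Ω.IsAdaptedFrame x₀ L B O)
    (hs : Ω.IsSelfStable D) (hD : D.ContMDiffCovariantDerivative ∞) (ht : D.torsion = 0)
    (hR : Ω.CurvatureVanishesOn D) {y : M} (hy : y ∈ O) (f a b : Fin p → ℝ) :
    mvfderiv (𝓡 n) (connCoeff D x₀ L B) y (∑ k, a k • B k y) f b
        - connCoeff D x₀ L B y (connCoeff D x₀ L B y f a) b
      = mvfderiv (𝓡 n) (connCoeff D x₀ L B) y (∑ k, b k • B k y) f a
        - connCoeff D x₀ L B y (connCoeff D x₀ L B y f b) a := by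
  set G := connCoeff D x₀ L B
  have hGs : ∀ z ∈ O, MDifferentiableAt (𝓡 n)
      𝓘(ℝ, (Fin p → ℝ) →L[ℝ] (Fin p → ℝ) →L[ℝ] (Fin p → ℝ)) G z := fun z hz ↦
    (h.contMDiffAt_connCoeff hD hz).mdifferentiableAt (by simp)
  have hfirst : ∀ a : Fin p → ℝ, ∀ z ∈ O, covField D (fun z ↦ ∑ k, a k • B k z)
      (fun z ↦ ∑ i, f i • B i z) z = ∑ l, G z f a l • B l z := by
    intro a z hz
    have := h.covariantDerivative_eq (D := D) hs hz (f := fun _ ↦ f) mdifferentiableAt_const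
      (W := fun z ↦ ∑ i, f i • B i z) (Filter.Eventually.of_forall fun _ ↦ rfl) a
    rw [mvfderiv_const] at this
    simpa [covField] using this
  have hsecond : ∀ a b : Fin p → ℝ, covField D (fun z ↦ ∑ k, a k • B k z)
      (covField D (fun z ↦ ∑ k, b k • B k z) (fun z ↦ ∑ i, f i • B i z)) y
      = ∑ l, (mvfderiv (𝓡 n) G y (∑ k, a k • B k y) f b + G y (G y f b) a) l • B l y := by
    intro a b
    obtain ⟨hd₁, hder₁⟩ := mvfderiv_clm_apply_const (F₂ := (Fin p → ℝ) →L[ℝ] (Fin p → ℝ)) (hGs y hy) f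
    obtain ⟨hd, hder₂⟩ := mvfderiv_clm_apply_const (F₂ := Fin p → ℝ) hd₁ b
    have hder : ∀ v, mvfderiv (𝓡 n) (fun z ↦ G z f b) y v = mvfderiv (𝓡 n) G y v f b := fun v ↦ by
      rw [hder₂, hder₁]
    have := h.covariantDerivative_eq (D := D) hs hy hd
      (W := covField D (fun z ↦ ∑ k, b k • B k z) (fun z ↦ ∑ i, f i • B i z))
      (by filter_upwards [h.isOpen.mem_nhds hy] with z hz using hfirst b z hz) a
    rw [hder] at this
    exact this
  have hR' := hR O h.isOpen _ _ _ (h.basis.isFieldOn h.isOpen f) (h.basis.isFieldOn h.isOpen a)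
    (h.basis.isFieldOn h.isOpen b) y hy
  simp only [riemannCurvature, Pi.sub_apply] at hR'
  rw [hsecond, hsecond, covField, h.mlieBracket_eq_zero hs ht a b hy, map_zero, sub_zero,
    sub_eq_zero] at hR'
  have := congrArg (fun v ↦ L (chartDeriv n x₀ y v)) hR'
  simp only [h.coord y hy] at this
  rw [sub_eq_sub_iff_add_eq_add, this]

end FlatCase

end TangentDistribution

/-! ### Parallel bases of a distribution without curvature -/

namespace TangentDistribution

section ParallelBasis

variable {n p : ℕ} {M : Type u} [TopologicalSpace M]
  [ChartedSpace (EuclideanSpace ℝ (Fin n)) M]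

/-- The coordinate expression, as a family of linear maps, of the frame `B`. -/
def chartFrame (x₀ : M) (B : Fin p → VField n M) (z : EuclideanSpace ℝ (Fin n)) :
    (Fin p → ℝ) →L[ℝ] EuclideanSpace ℝ (Fin n) :=
  ∑ i, ContinuousLinearMap.smulRightL ℝ (Fin p → ℝ) (EuclideanSpace ℝ (Fin n))
    (ContinuousLinearMap.proj (R := ℝ) (φ := fun _ : Fin p ↦ ℝ) i) (chartField x₀ (B i) z)

lemma chartFrame_apply (x₀ : M) (B : Fin p → VField n M) (z : EuclideanSpace ℝ (Fin n)) (a : Fin p → ℝ) :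
    chartFrame x₀ B z a = chartField x₀ (fun y ↦ ∑ i, a i • B i y) z := by
  rw [chartFrame, sum_apply, chartField, map_sum]
  refine Finset.sum_congr rfl fun i _ ↦ ?_
  rw [map_smul]
  rfl

variable [IsManifold (𝓡 n) ∞ M]
  {Ω : TangentDistribution n M p} {D : AffineConnection n M} {x₀ : M}
  {L : EuclideanSpace ℝ (Fin n) →L[ℝ] (Fin p → ℝ)} {B : Fin p → VField n M} {O : Set M}

lemma IsAdaptedFrame.contDiffAt_chartFrame (h : Ω.IsAdaptedFrame x₀ L B O) {y : M} (hy : y ∈ O) :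
    ContDiffAt ℝ ∞ (chartFrame x₀ B) (extChartAt (𝓡 n) x₀ y) :=
  ContDiffAt.sum fun i _ ↦ (ContinuousLinearMap.contDiff _).contDiffAt.comp _
    (((h.basis.smooth i).smoothFieldAt h.isOpen hy).chartField (h.subset_source hy))

lemma IsAdaptedFrame.fderiv_chartFrame_comm (h : Ω.IsAdaptedFrame x₀ L B O)
    (hs : Ω.IsSelfStable D) (ht : D.torsion = 0) {y : M} (hy : y ∈ O) (a b : Fin p → ℝ) :
    fderiv ℝ (chartFrame x₀ B) (extChartAt (𝓡 n) x₀ y)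
        (chartFrame x₀ B (extChartAt (𝓡 n) x₀ y) a) b
      = fderiv ℝ (chartFrame x₀ B) (extChartAt (𝓡 n) x₀ y)
        (chartFrame x₀ B (extChartAt (𝓡 n) x₀ y) b) a := by
  have hys := h.subset_source hy
  have hd := fun c ↦ ((h.basis.isFieldOn h.isOpen c).smooth.smoothFieldAt h.isOpen hy).diffFieldAt
  have key : ∀ a b : Fin p → ℝ, fderiv ℝ (chartFrame x₀ B) (extChartAt (𝓡 n) x₀ y)
      (chartFrame x₀ B (extChartAt (𝓡 n) x₀ y) a) b
      = mvfderiv (𝓡 n) (fun z ↦ mvfderiv (𝓡 n) (extChartAt (𝓡 n) x₀) z (∑ i, b i • B i z)) y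
        (∑ i, a i • B i y) := by
    intro a b
    have h1 := mvfderiv_eq_fderiv_chart hys
      (h := fun z ↦ mvfderiv (𝓡 n) (extChartAt (𝓡 n) x₀) z (∑ i, b i • B i z))
      ((hd b).chartField hys) (∑ i, a i • B i y)
    rw [h1, chartFrame_apply, chartField_extChartAt _ hys]
    have h2 := ((h.contDiffAt_chartFrame hy).differentiableAt (by simp)).hasFDerivAt.clm_apply
      (hasFDerivAt_const b _)
    have h3 : (fun z ↦ chartFrame x₀ B z b) = chartField x₀ fun y ↦ ∑ i, b i • B i y :=
      funext fun z ↦ chartFrame_apply x₀ B z b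
    rw [h3] at h2
    have h4 := congrArg (fun K : EuclideanSpace ℝ (Fin n) →L[ℝ] EuclideanSpace ℝ (Fin n) ↦
      K (chartDeriv n x₀ y (∑ i, a i • B i y))) h2.fderiv
    simp only [ContinuousLinearMap.comp_zero, zero_add, ContinuousLinearMap.flip_apply] at h4
    exact h4.symm
  have hbr := mvfderiv_mlieBracket (h := extChartAt (𝓡 n) x₀) (contMDiffAt_extChartAt' hys)
    (hd a) (hd b)
  rw [h.mlieBracket_eq_zero hs ht a b hy, map_zero] at hbr
  rw [key, key]
  exact (sub_eq_zero.1 hbr.symm)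

/-- A self-stable distribution on which the curvature vanishes has local bases of parallel
fields. -/
theorem IsSelfStable.isRegularlySelfStable [T2Space M] (hs : Ω.IsSelfStable D)
    (hD : D.ContMDiffCovariantDerivative ∞) (ht : D.torsion = 0) (hR : Ω.CurvatureVanishesOn D) :
    Ω.IsRegularlySelfStable D := by
  intro x₀
  obtain ⟨L, B, O, hx, h⟩ := Ω.exists_isAdaptedFrame x₀
  set G := connCoeff D x₀ L B
  have hnear : ∀ᶠ z in 𝓝 (extChartAt (𝓡 n) x₀ x₀), ∃ y ∈ O, z = extChartAt (𝓡 n) x₀ y := by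
    have h1 : ∀ᶠ z in 𝓝 (extChartAt (𝓡 n) x₀ x₀), (extChartAt (𝓡 n) x₀).symm z ∈ O :=
      (continuousAt_extChartAt_symm x₀).eventually (by simpa using h.isOpen.mem_nhds hx)
    filter_upwards [h1, extChartAt_target_mem_nhds (I := 𝓡 n) x₀] with z hz hzt
    exact ⟨_, hz, ((extChartAt (𝓡 n) x₀).right_inv hzt).symm⟩
  have hsymm : ∀ y ∈ O, (extChartAt (𝓡 n) x₀).symm (extChartAt (𝓡 n) x₀ y) = y := fun y hy ↦
    (extChartAt (𝓡 n) x₀).left_inv (by simpa using h.subset_source hy)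
  have hYa : ∀ y ∈ O, ∀ a, chartFrame x₀ B (extChartAt (𝓡 n) x₀ y) a
      = chartDeriv n x₀ y (∑ i, a i • B i y) := fun y hy a ↦ by
    rw [chartFrame_apply, chartField_extChartAt _ (h.subset_source hy)]
  have hΓs : ∀ y ∈ O, ContDiffAt ℝ ∞ (G ∘ (extChartAt (𝓡 n) x₀).symm) (extChartAt (𝓡 n) x₀ y) :=
    fun y hy ↦ (contMDiffAt_iff_contDiffAt_chart (h.subset_source hy)).1
      (h.contMDiffAt_connCoeff hD hy)
  obtain ⟨J, hJ0, hJ⟩ := exists_parallel_trivialization (Y := chartFrame x₀ B)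
    (Γ := G ∘ (extChartAt (𝓡 n) x₀).symm) (x₀ := extChartAt (𝓡 n) x₀ x₀)
    (hnear.mono (by rintro z ⟨y, hy, rfl⟩; exact h.contDiffAt_chartFrame hy))
    (hnear.mono (by rintro z ⟨y, hy, rfl⟩; exact hΓs y hy)) L
    (hnear.mono (by rintro z ⟨y, hy, rfl⟩ a; rw [hYa y hy, h.coord y hy]))
    (hnear.mono (by rintro z ⟨y, hy, rfl⟩ a b; exact h.fderiv_chartFrame_comm hs ht hy a b))
    (hnear.mono (by
      rintro z ⟨y, hy, rfl⟩ f a b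
      have h1 := h.connCoeff_integrable hs hD ht hR hy f a b
      have h2 := mvfderiv_eq_fderiv_chart (h.subset_source hy) (h := G)
        ((hΓs y hy).differentiableAt (by simp))
      rw [h2, h2] at h1
      rw [hYa y hy, hYa y hy, Function.comp_apply, hsymm y hy]
      exact h1))
  have hJc : ContDiffAt ℝ ∞ J (extChartAt (𝓡 n) x₀ x₀) := hJ.self_of_nhds.1
  have hunit : ∀ᶠ z in 𝓝 (extChartAt (𝓡 n) x₀ x₀), (J z).IsInvertible := by
    refine hJc.continuousAt.eventually ?_
    have := ContinuousLinearEquiv.nhds (ContinuousLinearEquiv.refl ℝ (Fin p → ℝ))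
    rw [hJ0]
    filter_upwards [this] with A hA
    exact hA
  have hall := (continuousAt_extChartAt (I := 𝓡 n) x₀).eventually (hJ.and hunit).eventually_nhds
  obtain ⟨V, hV, hVo, hxV⟩ := mem_nhds_iff.1 (hall.and (h.isOpen.mem_nhds hx))
  let K : EuclideanSpace ℝ (Fin n) → (Fin p → ℝ) →L[ℝ] (Fin p → ℝ) := fun z ↦ (J z).inverse
  have hKs : ∀ z, ContDiffAt ℝ ∞ J z → (J z).IsInvertible → ContDiffAt ℝ ∞ K z := by
    intro z hz hinv
    have h1 : ContDiffAt ℝ ∞ ContinuousLinearMap.inverse (J z) := by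
      obtain ⟨e, he⟩ := hinv
      rw [← he]
      exact contDiffAt_map_inverse e
    exact h1.comp z hz
  let κ : M → (Fin p → ℝ) →L[ℝ] (Fin p → ℝ) := fun y ↦ K (extChartAt (𝓡 n) x₀ y)
  have hVO : V ⊆ O := fun y hy ↦ (hV hy).2
  have hκ : ∀ y ∈ V, ContMDiffAt (𝓡 n) 𝓘(ℝ, (Fin p → ℝ) →L[ℝ] (Fin p → ℝ)) ∞ κ y := fun y hy ↦
    (hKs _ (hV hy).1.self_of_nhds.1.1
      (hV hy).1.self_of_nhds.2).contMDiffAt_comp_chart (h.subset_source (hVO hy))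
  -- Differentiate `J (K e) = e`.
  have hdκ : ∀ y ∈ V, ∀ e a : Fin p → ℝ,
      mvfderiv (𝓡 n) (fun y ↦ κ y e) y (∑ k, a k • B k y) = - G y (κ y e) a := by
    intro y hy e a
    have hnhds := (hV hy).1
    obtain ⟨⟨hJs, hJd⟩, hinv⟩ := hnhds.self_of_nhds
    have hKd : DifferentiableAt ℝ (fun z ↦ K z e) (extChartAt (𝓡 n) x₀ y) :=
      ((hKs _ hJs hinv).differentiableAt (by simp)).clm_apply (differentiableAt_const e)
    have h1 := (hJs.differentiableAt (by simp)).hasFDerivAt.clm_apply hKd.hasFDerivAt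
    have h2 : (fun z ↦ J z (K z e)) =ᶠ[𝓝 (extChartAt (𝓡 n) x₀ y)] fun _ ↦ e := by
      filter_upwards [hnhds] with z hz
      exact (hz.2.inverse_apply_eq.1 rfl).symm
    have h3 := h1.unique ((hasFDerivAt_const e _).congr_of_eventuallyEq h2)
    have h4 := congrArg (fun A : EuclideanSpace ℝ (Fin n) →L[ℝ] (Fin p → ℝ) ↦
      A (chartFrame x₀ B (extChartAt (𝓡 n) x₀ y) a)) h3
    simp only [add_apply, ContinuousLinearMap.comp_apply, ContinuousLinearMap.flip_apply,
      zero_apply] at h4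
    rw [hJd, ← map_add, Function.comp_apply, hsymm y (hVO hy)] at h4
    have h5 := (map_eq_zero_iff _ hinv.injective).1 h4
    rw [mvfderiv_chart_comp (h.subset_source (hVO hy)) hKd, ← hYa y (hVO hy)]
    exact eq_neg_of_add_eq_zero_left h5
  have hbasis := h.basis.change h.isOpen hVO hκ fun y hy ↦ by
    obtain ⟨e, he⟩ := (hV hy).1.self_of_nhds.2
    change Function.Bijective (J (extChartAt (𝓡 n) x₀ y)).inverse
    rw [← he, ContinuousLinearMap.inverse_equiv]
    exact e.symm.bijective
  refine ⟨V, hVo, hxV, _, hbasis, fun Z hZ j y hy ↦ ?_⟩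
  obtain ⟨a, ha⟩ := h.basis.exists_eq_sum (hVO hy) (hZ.mem y hy)
  have hd : MDifferentiableAt (𝓡 n) 𝓘(ℝ, Fin p → ℝ) (fun y ↦ κ y (Pi.single j 1)) y :=
    (mvfderiv_clm_apply_const ((hκ y hy).mdifferentiableAt (by simp)) _).1
  have := h.covariantDerivative_eq hs (hVO hy) hd
    (W := fun y ↦ ∑ i, κ y (Pi.single j 1) i • B i y) (Filter.Eventually.of_forall fun _ ↦ rfl) a
  rw [hdκ y hy, neg_add_cancel] at this
  rw [covField, ← ha, this]
  simp

end ParallelBasis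

end TangentDistribution

/-! ### Vector fields along a leaf -/

namespace TangentDistribution

namespace Leaf

variable {n p : ℕ} {M : Type u} [TopologicalSpace M]
  [ChartedSpace (EuclideanSpace ℝ (Fin n)) M] [IsManifold (𝓡 n) ∞ M]
  {Ω : TangentDistribution n M p} (L : Ω.Leaf)

lemma mdifferentiableAt_incl (y : L.carrier) : MDifferentiableAt (𝓡 p) (𝓡 n) L.incl y :=
  L.smooth.mdifferentiableAt (by simp)

lemma continuous_incl : Continuous L.incl := L.smooth.continuous

lemma push_injective (y : L.carrier) : Function.Injective (L.push y) := L.immersion y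

lemma mem_range_push {y : L.carrier} {v : TangentSpace (𝓡 n) (L.incl y)} :
    v ∈ range (L.push y) ↔ v ∈ Ω.space (L.incl y) := by
  rw [← L.tangent y]
  rfl

lemma push_mem (y : L.carrier) (v : TangentSpace (𝓡 p) y) : L.push y v ∈ Ω.space (L.incl y) :=
  L.mem_range_push.1 (mem_range_self v)

lemma contMDiffAt_chart_incl (y : L.carrier) :
    ContMDiffAt (𝓡 p) 𝓘(ℝ, EuclideanSpace ℝ (Fin n)) ∞
      (fun z ↦ extChartAt (𝓡 n) (L.incl y) (L.incl z)) y :=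
  contMDiffAt_extChartAt.comp y L.smooth.contMDiffAt

lemma mvfderiv_chart_incl {x₀ : M} {y : L.carrier}
    (hy : L.incl y ∈ (chartAt (EuclideanSpace ℝ (Fin n)) x₀).source) (v : TangentSpace (𝓡 p) y) :
    mvfderiv (𝓡 p) (fun z ↦ extChartAt (𝓡 n) x₀ (L.incl z)) y v
      = chartDeriv n x₀ (L.incl y) (L.push y v) :=
  mvfderiv_comp_mfderiv (mdifferentiableAt_extChartAt hy) (L.mdifferentiableAt_incl y) v

lemma eventually_incl_mem {y : L.carrier} {U : Set M} (hU : IsOpen U) (hy : L.incl y ∈ U) :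
    ∀ᶠ z in 𝓝 y, L.incl z ∈ U :=
  L.continuous_incl.continuousAt.eventually (hU.mem_nhds hy)

lemma eventually_mvfderiv_chart_incl {y : L.carrier} {X' : VField p L.carrier} {X : VField n M}
    (h : ∀ᶠ z in 𝓝 y, L.push z (X' z) = X (L.incl z)) :
    (fun z ↦ mvfderiv (𝓡 p) (fun z ↦ extChartAt (𝓡 n) (L.incl y) (L.incl z)) z (X' z)) =ᶠ[𝓝 y]
      fun z ↦ chartDeriv n (L.incl y) (L.incl z) (X (L.incl z)) := by
  filter_upwards [h, L.eventually_incl_mem (chartAt (EuclideanSpace ℝ (Fin n)) (L.incl y)).open_source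
    (mem_chart_source _ (L.incl y))] with z hz hzs
  rw [L.mvfderiv_chart_incl hzs, hz]

/-- A field on a leaf is smooth if it is the restriction of a smooth field. -/
theorem smoothFieldAt_of_push {y : L.carrier} {X' : VField p L.carrier} {X : VField n M}
    (hX : SmoothFieldAt X (L.incl y)) (h : ∀ᶠ z in 𝓝 y, L.push z (X' z) = X (L.incl z)) :
    SmoothFieldAt X' y := by
  have hx := mem_chart_source (EuclideanSpace ℝ (Fin n)) (L.incl y)
  refine smoothFieldAt_of_mvfderiv (L.contMDiffAt_chart_incl y) ?_ ?_
  · intro v w hvw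
    rw [L.mvfderiv_chart_incl hx, L.mvfderiv_chart_incl hx] at hvw
    exact L.push_injective y (chartDeriv_injective hx hvw)
  · exact (((smoothFieldAt_iff hx).1 hX).comp y L.smooth.contMDiffAt).congr_of_eventuallyEq
      (L.eventually_mvfderiv_chart_incl h)

/-- The bracket of the restrictions to a leaf is the restriction of the bracket. -/
theorem push_mlieBracket {y : L.carrier} {V' W' : VField p L.carrier} {V W : VField n M}
    (hV' : DiffFieldAt V' y) (hW' : DiffFieldAt W' y)
    (hV : DiffFieldAt V (L.incl y)) (hW : DiffFieldAt W (L.incl y))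
    (hVV : ∀ᶠ z in 𝓝 y, L.push z (V' z) = V (L.incl z))
    (hWW : ∀ᶠ z in 𝓝 y, L.push z (W' z) = W (L.incl z)) :
    L.push y (VectorField.mlieBracket (𝓡 p) V' W' y)
      = VectorField.mlieBracket (𝓡 n) V W (L.incl y) := by
  have hx := mem_chart_source (EuclideanSpace ℝ (Fin n)) (L.incl y)
  refine chartDeriv_injective hx ?_
  have h1 := mvfderiv_mlieBracket (L.contMDiffAt_chart_incl y) hV' hW'
  have h2 := mvfderiv_mlieBracket (h := extChartAt (𝓡 n) (L.incl y)) contMDiffAt_extChartAt hV hW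
  rw [L.mvfderiv_chart_incl hx, mvfderiv_congr (L.eventually_mvfderiv_chart_incl hVV),
    mvfderiv_congr (L.eventually_mvfderiv_chart_incl hWW),
    mvfderiv_comp_mfderiv (h := fun x ↦ chartDeriv n (L.incl y) x (W x))
      ((diffFieldAt_iff hx).1 hW) (L.mdifferentiableAt_incl y),
    mvfderiv_comp_mfderiv (h := fun x ↦ chartDeriv n (L.incl y) x (V x))
      ((diffFieldAt_iff hx).1 hV) (L.mdifferentiableAt_incl y)] at h1
  have hVy := hVV.self_of_nhds
  have hWy := hWW.self_of_nhds
  rw [push] at hVy hWy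
  rw [hVy, hWy] at h1
  exact h1.trans h2.symm

/-- The restriction to a leaf of a field that is tangent to it. -/
def pull (X : VField n M) : VField p L.carrier :=
  fun y ↦ Function.invFun (L.push y) (X (L.incl y))

lemma push_pull {X : VField n M} {y : L.carrier} (h : X (L.incl y) ∈ Ω.space (L.incl y)) :
    L.push y (L.pull X y) = X (L.incl y) :=
  Function.invFun_eq (L.mem_range_push.2 h)

lemma smoothFieldOn_pull {X : VField n M} {U : Set M} (hU : IsOpen U) (hX : Ω.IsFieldOn X U) :
    SmoothFieldOn (L.pull X) (L.incl ⁻¹' U) := by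
  intro y hy
  refine (L.smoothFieldAt_of_push (hX.smooth.smoothFieldAt hU hy) ?_).contMDiffWithinAt
  filter_upwards [L.eventually_incl_mem hU hy] with z hz using L.push_pull (hX.mem _ hz)

lemma isBasisOn_pull {X : Fin p → VField n M} {U : Set M} (hU : IsOpen U)
    (hX : IsBasisOn Ω.space X U) :
    IsBasisOn (fun _ ↦ ⊤) (fun i ↦ L.pull (X i)) (L.incl ⁻¹' U) := by
  have hmem : ∀ i, ∀ x ∈ U, X i x ∈ Ω.space x := fun i x hx ↦
    hX.span_eq x hx ▸ Submodule.subset_span (mem_range_self i)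
  refine ⟨fun i ↦ L.smoothFieldOn_pull hU ⟨hX.smooth i, hmem i⟩, fun y hy ↦ ?_, fun y hy ↦ ?_⟩
  · have h := hX.linearIndependent (L.incl y) hy
    refine LinearIndependent.of_comp (L.push y).toLinearMap ?_
    convert h using 1
    ext1 i
    exact L.push_pull (hmem i _ hy)
  · rw [eq_top_iff]
    intro v _
    obtain ⟨a, ha⟩ := hX.exists_eq_sum hy (L.push_mem y v)
    have : v = ∑ i, a i • L.pull (X i) y := by
      refine L.push_injective y ?_
      rw [← ha, map_sum]
      exact Finset.sum_congr rfl fun i _ ↦ by rw [map_smul, L.push_pull (hmem i _ hy)]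
    rw [this]
    exact Submodule.sum_mem _ fun i _ ↦
      Submodule.smul_mem _ _ (Submodule.subset_span (mem_range_self i))

end Leaf

end TangentDistribution

/-! ### Connections defined by frames -/

section FrameDerivative

variable {m p : ℕ} {N : Type*} [TopologicalSpace N] [ChartedSpace (EuclideanSpace ℝ (Fin m)) N]

/-- The derivative of a vector field, computed by differentiating its coefficients `θ` with
respect to the frame `E`. -/
def frameDerivative (θ : Π z : N, TangentSpace (𝓡 m) z →L[ℝ] (Fin p → ℝ)) (E : Fin p → VField m N)
    (X : VField m N) (y : N) : TangentSpace (𝓡 m) y →L[ℝ] TangentSpace (𝓡 m) y :=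
  ∑ i, ((ContinuousLinearMap.proj (R := ℝ) (φ := fun _ : Fin p ↦ ℝ) i) ∘L
    mvfderiv (𝓡 m) (fun z ↦ θ z (X z)) y).smulRight (E i y)

lemma frameDerivative_apply (θ : Π z : N, TangentSpace (𝓡 m) z →L[ℝ] (Fin p → ℝ))
    (E : Fin p → VField m N) (X : VField m N) (y : N) (v : TangentSpace (𝓡 m) y) :
    frameDerivative θ E X y v = ∑ i, mvfderiv (𝓡 m) (fun z ↦ θ z (X z)) y v i • E i y := by
  rw [frameDerivative, sum_apply]
  rfl

variable [IsManifold (𝓡 m) ∞ N]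

/-- Differentiating the coefficients with respect to a frame, which may depend on the point,
defines a connection. -/
def frameConnection (θ : N → Π z : N, TangentSpace (𝓡 m) z →L[ℝ] (Fin p → ℝ))
    (E : N → Fin p → VField m N)
    (hθE : ∀ y, ∀ v : TangentSpace (𝓡 m) y, v = ∑ i, θ y y v i • E y i y)
    (hθ : ∀ y, ∀ Z : VField m N, DiffFieldAt Z y →
      MDifferentiableAt (𝓡 m) 𝓘(ℝ, Fin p → ℝ) (fun z ↦ θ y z (Z z)) y) :
    AffineConnection m N where
  toFun X y := frameDerivative (θ y) (E y) X y
  isCovariantDerivativeOnUniv :=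
    { add := by
        intro σ σ' y hσ hσ' _
        ext1 v
        have e : (fun z ↦ θ y z ((σ + σ') z)) = fun z ↦ θ y z (σ z) + θ y z (σ' z) :=
          funext fun z ↦ map_add _ _ _
        rw [add_apply, frameDerivative_apply, frameDerivative_apply, frameDerivative_apply, e,
          mvfderiv_fun_add (hθ y σ hσ) (hθ y σ' hσ'), ← Finset.sum_add_distrib]
        exact Finset.sum_congr rfl fun i _ ↦ add_smul _ _ _
      leibniz := by
        intro σ g y hσ hg _
        ext1 v
        have e : (fun z ↦ θ y z ((g • σ) z)) = fun z ↦ g z • θ y z (σ z) :=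
          funext fun z ↦ (θ y z).map_smul (g z) (σ z)
        have h1 : (g y • frameDerivative (θ y) (E y) σ y
            + (mvfderiv (𝓡 m) g y).smulRight (σ y)) v
            = g y • frameDerivative (θ y) (E y) σ y v
              + mvfderiv (𝓡 m) g y v • ∑ i, θ y y (σ y) i • E y i y := by
          rw [← hθE]
          rfl
        rw [h1, frameDerivative_apply, frameDerivative_apply, e, mvfderiv_fun_smul hg (hθ y σ hσ),
          Finset.smul_sum, Finset.smul_sum, ← Finset.sum_add_distrib]
        refine Finset.sum_congr rfl fun i _ ↦ ?_
        rw [smul_smul, smul_smul, ← add_smul]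
        rfl }

/-- A family of endomorphisms of the tangent spaces is smooth if it preserves smoothness of vector
fields. -/
theorem contMDiffAt_endomorphism {Φ : Π z : N, TangentSpace (𝓡 m) z →L[ℝ] TangentSpace (𝓡 m) z}
    {y : N} (h : ∀ V : VField m N, (∀ᶠ z in 𝓝 y, SmoothFieldAt V z) →
      SmoothFieldAt (fun z ↦ Φ z (V z)) y) :
    ContMDiffAt (𝓡 m)
      ((𝓡 m).prod 𝓘(ℝ, EuclideanSpace ℝ (Fin m) →L[ℝ] EuclideanSpace ℝ (Fin m))) ∞
      (fun z ↦ (⟨z, Φ z⟩ : TotalSpace (EuclideanSpace ℝ (Fin m) →L[ℝ] EuclideanSpace ℝ (Fin m))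
        fun z ↦ TangentSpace (𝓡 m) z →L[ℝ] TangentSpace (𝓡 m) z)) y := by
  have hy := mem_chart_source (EuclideanSpace ℝ (Fin m)) y
  rw [contMDiffAt_hom_bundle]
  refine ⟨contMDiffAt_id, ?_⟩
  -- The fields with constant coordinates.
  let V : Fin m → VField m N := fun k z ↦
    (chartDeriv m y z).inverse (EuclideanSpace.single k (1 : ℝ))
  have hVc : ∀ k, ∀ z ∈ (chartAt (EuclideanSpace ℝ (Fin m)) y).source,
      chartDeriv m y z (V k z) = EuclideanSpace.single k (1 : ℝ) := fun k z hz ↦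
    ((chartDeriv_isInvertible hz).inverse_apply_eq.1 rfl).symm
  have hV : ∀ k, ∀ᶠ z in 𝓝 y, SmoothFieldAt (V k) z := by
    intro k
    filter_upwards [(chartAt (EuclideanSpace ℝ (Fin m)) y).open_source.mem_nhds hy] with z hz
    rw [smoothFieldAt_iff hz]
    refine contMDiffAt_const (c := EuclideanSpace.single k (1 : ℝ)) |>.congr_of_eventuallyEq ?_
    filter_upwards [(chartAt (EuclideanSpace ℝ (Fin m)) y).open_source.mem_nhds hz] with w hw
    exact hVc k w hw
  let S (k : Fin m) : EuclideanSpace ℝ (Fin m) →L[ℝ]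
      EuclideanSpace ℝ (Fin m) →L[ℝ] EuclideanSpace ℝ (Fin m) :=
    ContinuousLinearMap.smulRightL ℝ (EuclideanSpace ℝ (Fin m)) (EuclideanSpace ℝ (Fin m))
      (EuclideanSpace.proj k)
  have hsm : ContMDiffAt (𝓡 m) 𝓘(ℝ, EuclideanSpace ℝ (Fin m) →L[ℝ] EuclideanSpace ℝ (Fin m)) ∞
      (fun z ↦ ∑ k, S k (chartDeriv m y z (Φ z (V k z)))) y :=
    contMDiffAt_finsetSum fun k _ ↦
      (S k).contMDiff.contMDiffAt.comp y ((smoothFieldAt_iff hy).1 (h (V k) (hV k)))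
  refine hsm.congr_of_eventuallyEq ?_
  filter_upwards [(chartAt (EuclideanSpace ℝ (Fin m)) y).open_source.mem_nhds hy] with z hz
  rw [ContinuousLinearMap.inCoordinates_eq (by exact hz) (by exact hz)]
  ext1 a
  obtain ⟨v, rfl⟩ := chartDeriv_surjective hz a
  have h1 : v = ∑ k, (chartDeriv m y z v) k • V k z := by
    refine chartDeriv_injective hz ?_
    rw [map_sum]
    conv_lhs => rw [← (EuclideanSpace.basisFun (Fin m) ℝ).sum_repr (chartDeriv m y z v)]
    refine Finset.sum_congr rfl fun k _ ↦ ?_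
    rw [map_smul, hVc k z hz]
    simp
  have h2 : (Trivialization.continuousLinearEquivAt ℝ (trivializationAt (EuclideanSpace ℝ (Fin m))
      (TangentSpace (𝓡 m) : N → Type _) y) z (by exact hz)).symm (chartDeriv m y z v) = v := by
    rw [ContinuousLinearEquiv.symm_apply_eq, ← trivialization_eq_chartDeriv hz]
    rfl
  have h3 : ∀ w : TangentSpace (𝓡 m) z, Trivialization.continuousLinearEquivAt ℝ
      (trivializationAt (EuclideanSpace ℝ (Fin m)) (TangentSpace (𝓡 m) : N → Type _) y) z
      (by exact hz) w = chartDeriv m y z w := fun w ↦ trivialization_eq_chartDeriv hz w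
  simp only [ContinuousLinearMap.comp_apply, ContinuousLinearEquiv.coe_coe]
  rw [h2, h3, sum_apply]
  conv_lhs => rw [h1, map_sum, map_sum]
  refine Finset.sum_congr rfl fun k _ ↦ ?_
  rw [map_smul, map_smul]
  rfl

end FrameDerivative

/-! ### The flat connection of a leaf -/

namespace TangentDistribution

/-- A local basis of `Ω` by fields that are parallel in the directions of `Ω`. -/
structure IsParallelBasisOn {n p : ℕ} {M : Type u} [TopologicalSpace M]
    [ChartedSpace (EuclideanSpace ℝ (Fin n)) M] [IsManifold (𝓡 n) ∞ M]
    (D : AffineConnection n M) (Ω : TangentDistribution n M p) (X : Fin p → VField n M)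
    (U : Set M) : Prop where
  isOpen : IsOpen U
  basis : IsBasisOn Ω.space X U
  parallel (x : M) (hx : x ∈ U) (v : TangentSpace (𝓡 n) x) (hv : v ∈ Ω.space x) (i : Fin p) :
    D (X i) x v = 0

namespace Leaf

variable {n p : ℕ} {M : Type u} [TopologicalSpace M]
  [ChartedSpace (EuclideanSpace ℝ (Fin n)) M] [IsManifold (𝓡 n) ∞ M]
  {Ω : TangentDistribution n M p} {D : AffineConnection n M}

/-- The restrictions to the leaf of parallel fields of `Ω` are parallel for `D'`, so that `D'`
differentiates the coefficients with respect to such fields. -/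
def IsParallelConnection (L : Ω.Leaf) (D : AffineConnection n M)
    (D' : AffineConnection p L.carrier) : Prop :=
  ∀ X U, IsParallelBasisOn D Ω X U → ∀ y, L.incl y ∈ U →
    ∀ (X' : VField p L.carrier) (f : L.carrier → Fin p → ℝ),
      MDifferentiableAt (𝓡 p) 𝓘(ℝ, Fin p → ℝ) f y →
      (∀ᶠ z in 𝓝 y, X' z = ∑ i, f z i • L.pull (X i) z) →
      ∀ v, D' X' y v = ∑ i, mvfderiv (𝓡 p) f y v i • L.pull (X i) y

lemma _root_.TangentDistribution.IsParallelBasisOn.mem {X : Fin p → VField n M} {U : Set M}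
    (hX : IsParallelBasisOn D Ω X U) (i : Fin p) {x : M} (hx : x ∈ U) : X i x ∈ Ω.space x :=
  hX.basis.span_eq x hx ▸ Submodule.subset_span (mem_range_self i)

lemma _root_.TangentDistribution.IsParallelBasisOn.diffFieldAt {X : Fin p → VField n M}
    {U : Set M} (hX : IsParallelBasisOn D Ω X U) (i : Fin p) {x : M} (hx : x ∈ U) :
    DiffFieldAt (X i) x :=
  ((hX.basis.smooth i).smoothFieldAt hX.isOpen hx).diffFieldAt

variable (L : Ω.Leaf)

/-- A field on `M` that is tangent to the leaf along it is differentiated by differentiating its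
coefficients with respect to parallel fields. -/
lemma covariantDerivative_push {X : Fin p → VField n M} {U : Set M}
    (hX : IsParallelBasisOn D Ω X U) {y : L.carrier} (hy : L.incl y ∈ U) {Y : VField n M}
    (hY : DiffFieldAt Y (L.incl y)) {f : L.carrier → Fin p → ℝ}
    (hf : MDifferentiableAt (𝓡 p) 𝓘(ℝ, Fin p → ℝ) f y)
    (h : ∀ᶠ z in 𝓝 y, Y (L.incl z) = ∑ i, f z i • X i (L.incl z)) (v : TangentSpace (𝓡 p) y) :
    D Y (L.incl y) (L.push y v) = ∑ i, mvfderiv (𝓡 p) f y v i • X i (L.incl y) := by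
  have h1 := covariantDerivative_along D (L.mdifferentiableAt_incl y) hY
    (fun i ↦ hX.diffFieldAt i hy) hf h v
  have h2 := fun i ↦ hX.parallel _ hy _ (L.push_mem y v) i
  rw [push] at h2 ⊢
  simpa only [h2, smul_zero, add_zero] using h1

lemma push_sum_pull {X : Fin p → VField n M} {U : Set M} (hX : IsParallelBasisOn D Ω X U)
    {y : L.carrier} (hy : L.incl y ∈ U) (a : Fin p → ℝ) :
    L.push y (∑ i, a i • L.pull (X i) y) = ∑ i, a i • X i (L.incl y) := by
  rw [map_sum]
  exact Finset.sum_congr rfl fun i _ ↦ by rw [map_smul, L.push_pull (hX.mem i hy)]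

/-- Coefficients with respect to different parallel bases have the same derivatives. -/
lemma sum_mvfderiv_pull_eq {X X₀ : Fin p → VField n M} {U U₀ : Set M}
    (hX : IsParallelBasisOn D Ω X U) (hX₀ : IsParallelBasisOn D Ω X₀ U₀) {y : L.carrier}
    (hy : L.incl y ∈ U) (hy₀ : L.incl y ∈ U₀)
    {f f₀ : L.carrier → Fin p → ℝ} (hf : MDifferentiableAt (𝓡 p) 𝓘(ℝ, Fin p → ℝ) f y)
    (h : ∀ᶠ z in 𝓝 y, ∑ i, f z i • L.pull (X i) z = ∑ i, f₀ z i • L.pull (X₀ i) z)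
    (v : TangentSpace (𝓡 p) y) :
    ∑ i, mvfderiv (𝓡 p) f y v i • L.pull (X i) y
      = ∑ i, mvfderiv (𝓡 p) f₀ y v i • L.pull (X₀ i) y := by
  obtain ⟨θ, hθ⟩ := hX₀.basis.exists_coeff hX₀.isOpen hy₀
  -- The functions `A i` are the coefficients of `X i` with respect to `X₀`.
  let A : Fin p → L.carrier → Fin p → ℝ := fun i z ↦ θ (L.incl z) (X i (L.incl z))
  have hAd : ∀ i, MDifferentiableAt (𝓡 p) 𝓘(ℝ, Fin p → ℝ) (A i) y := fun i ↦
    (hθ.self_of_nhds.2.2 (X i) (hX.diffFieldAt i hy)).comp y (L.mdifferentiableAt_incl y)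
  have hA : ∀ᶠ z in 𝓝 y, ∀ i, X i (L.incl z) = ∑ j, A i z j • X₀ j (L.incl z) := by
    filter_upwards [L.continuous_incl.continuousAt.eventually hθ,
      L.eventually_incl_mem hX.isOpen hy] with z hz hzU i
    exact hz.1 _ (hX.mem i hzU)
  have hli := hX₀.basis.linearIndependent _ hy₀
  have hdA : ∀ i, mvfderiv (𝓡 p) (A i) y v = 0 := by
    intro i
    have h1 := L.covariantDerivative_push hX₀ hy₀ (hX.diffFieldAt i hy) (hAd i)
      (hA.mono fun z hz ↦ hz i) v
    rw [hX.parallel _ hy _ (L.push_mem y v)] at h1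
    exact funext (Fintype.linearIndependent_iff.1 hli _ h1.symm)
  have hcoef : f₀ =ᶠ[𝓝 y] fun z ↦ ∑ i, f z i • A i z := by
    filter_upwards [h, hA, L.eventually_incl_mem hX.isOpen hy,
      L.eventually_incl_mem hX₀.isOpen hy₀] with z hz hA hzU hzU₀
    have h1 := congrArg (L.push z) hz
    rw [L.push_sum_pull hX hzU, L.push_sum_pull hX₀ hzU₀] at h1
    have h2 : ∑ i, f z i • X i (L.incl z) = ∑ j, (∑ i, f z i • A i z) j • X₀ j (L.incl z) := by
      simp only [hA, Finset.smul_sum, Finset.sum_apply, Finset.sum_smul, Pi.smul_apply, smul_smul,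
        smul_eq_mul]
      exact Finset.sum_comm
    rw [h2] at h1
    have h3 := Fintype.linearIndependent_iff.1 (hX₀.basis.linearIndependent _ hzU₀)
      (f₀ z - ∑ i, f z i • A i z) (by
        simp only [Pi.sub_apply, sub_smul, Finset.sum_sub_distrib]
        rw [sub_eq_zero]
        exact h1.symm)
    exact sub_eq_zero.1 (funext h3)
  have hdf : mvfderiv (𝓡 p) f₀ y v = ∑ i, mvfderiv (𝓡 p) f y v i • A i y := by
    rw [mvfderiv_congr hcoef, (mvfderiv_finset_sum (f := fun i z ↦ f z i • A i z) Finset.univ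
      (fun i ↦ (mvfderiv_pi_apply hf v i).1.smul (hAd i)) v).2]
    refine Finset.sum_congr rfl fun i _ ↦ ?_
    rw [mvfderiv_fun_smul (mvfderiv_pi_apply hf v i).1 (hAd i)]
    simp [hdA, (mvfderiv_pi_apply hf v i).2]
  refine L.push_injective y ?_
  rw [L.push_sum_pull hX hy, L.push_sum_pull hX₀ hy₀, hdf]
  simp only [hA.self_of_nhds, Finset.smul_sum, Finset.sum_apply, Finset.sum_smul, Pi.smul_apply,
    smul_smul, smul_eq_mul]
  exact Finset.sum_comm

lemma _root_.TangentDistribution.IsRegularlySelfStable.exists_isParallelBasisOn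
    (h : Ω.IsRegularlySelfStable D) (x : M) :
    ∃ X U, x ∈ U ∧ IsParallelBasisOn D Ω X U := by
  obtain ⟨U, hU, hx, X, hX, hpar⟩ := h.exists_parallel_basis x
  exact ⟨X, U, hx, hU, hX, hpar⟩

/-- Since the derivatives of coefficients do not depend on the parallel basis, a basis chosen at
every point gives a connection, without any patching. -/
theorem exists_isParallelConnection (h : Ω.IsRegularlySelfStable D) :
    ∃ D' : AffineConnection p L.carrier, L.IsParallelConnection D D' := by
  choose X U hxU hX using fun y ↦ h.exists_isParallelBasisOn (L.incl y)
  choose θ hθ using fun y ↦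
    (L.isBasisOn_pull (hX y).isOpen (hX y).basis).exists_coeff
      ((hX y).isOpen.preimage L.continuous_incl) (hxU y)
  refine ⟨frameConnection θ (fun y i ↦ L.pull (X y i))
    (fun y v ↦ (hθ y).self_of_nhds.1 v trivial) fun y ↦ (hθ y).self_of_nhds.2.2, ?_⟩
  intro X₁ U₁ hX₁ y hy X' f hf hX' v
  have hX'd : DiffFieldAt X' y :=
    (DiffFieldAt.sum_smul hf fun i ↦ (((L.isBasisOn_pull hX₁.isOpen hX₁.basis).smooth i).smoothFieldAt
      (hX₁.isOpen.preimage L.continuous_incl) hy).diffFieldAt).congr_of_eventuallyEq (by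
        filter_upwards [hX'] with z hz
        rw [hz])
  refine (frameDerivative_apply _ _ _ _ _).trans ?_
  refine L.sum_mvfderiv_pull_eq (hX y) hX₁ (hxU y) hy ((hθ y).self_of_nhds.2.2 X' hX'd) ?_ v
  filter_upwards [hX', hθ y] with z hz hθz
  rw [← hz]
  exact (hθz.1 _ trivial).symm

end Leaf

end TangentDistribution

lemma mvfderiv_mul_mul_apply {n : ℕ} {M : Type*} [TopologicalSpace M]
    [ChartedSpace (EuclideanSpace ℝ (Fin n)) M] {a b c : M → ℝ} {x : M}
    (ha : MDifferentiableAt (𝓡 n) 𝓘(ℝ, ℝ) a x) (hb : MDifferentiableAt (𝓡 n) 𝓘(ℝ, ℝ) b x)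
    (hc : MDifferentiableAt (𝓡 n) 𝓘(ℝ, ℝ) c x) (v : TangentSpace (𝓡 n) x) :
    mvfderiv (𝓡 n) (fun y ↦ a y * b y * c y) x v
      = mvfderiv (𝓡 n) a x v * b x * c x + a x * mvfderiv (𝓡 n) b x v * c x
        + a x * b x * mvfderiv (𝓡 n) c x v := by
  have hab : MDifferentiableAt (𝓡 n) 𝓘(ℝ, ℝ) (fun y ↦ a y * b y) x := ha.mul hb
  rw [mvfderiv_fun_mul hab hc, mvfderiv_fun_mul ha hb]
  simp only [add_apply, smul_apply, smul_eq_mul]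
  ring

namespace TangentDistribution

namespace Leaf

section ParallelConnection

variable {n p : ℕ} {M : Type u} [TopologicalSpace M]
  [ChartedSpace (EuclideanSpace ℝ (Fin n)) M] [IsManifold (𝓡 n) ∞ M]
  {Ω : TangentDistribution n M p} {D : AffineConnection n M}
  {L : Ω.Leaf} {D' : AffineConnection p L.carrier} {X : Fin p → VField n M} {U : Set M}

lemma smoothFieldAt_pull (hX : IsParallelBasisOn D Ω X U) (i : Fin p) {y : L.carrier}
    (hy : L.incl y ∈ U) : SmoothFieldAt (L.pull (X i)) y :=
  ((L.isBasisOn_pull hX.isOpen hX.basis).smooth i).smoothFieldAt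
    (hX.isOpen.preimage L.continuous_incl) hy

lemma exists_coeff_pull (hX : IsParallelBasisOn D Ω X U) {y : L.carrier} (hy : L.incl y ∈ U) :
    ∃ θ : Π z : L.carrier, TangentSpace (𝓡 p) z →L[ℝ] (Fin p → ℝ), ∀ᶠ z in 𝓝 y,
      (∀ v, v = ∑ i, θ z v i • L.pull (X i) z) ∧
      (∀ Z : VField p L.carrier, SmoothFieldAt Z z →
        ContMDiffAt (𝓡 p) 𝓘(ℝ, Fin p → ℝ) ∞ (fun w ↦ θ w (Z w)) z) ∧
      (∀ Z : VField p L.carrier, DiffFieldAt Z z →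
        MDifferentiableAt (𝓡 p) 𝓘(ℝ, Fin p → ℝ) (fun w ↦ θ w (Z w)) z) := by
  obtain ⟨θ, hθ⟩ := (L.isBasisOn_pull hX.isOpen hX.basis).exists_coeff
    (hX.isOpen.preimage L.continuous_incl) hy
  exact ⟨θ, hθ.mono fun z hz ↦ ⟨fun v ↦ hz.1 v trivial, hz.2⟩⟩

lemma IsParallelConnection.sum_smul_pull (hD' : L.IsParallelConnection D D')
    (hX : IsParallelBasisOn D Ω X U) {y : L.carrier} (hy : L.incl y ∈ U) (a : Fin p → ℝ)
    (v : TangentSpace (𝓡 p) y) : D' (fun z ↦ ∑ i, a i • L.pull (X i) z) y v = 0 := by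
  rw [hD' X U hX y hy _ (fun _ ↦ a) mdifferentiableAt_const
    (Filter.Eventually.of_forall fun _ ↦ rfl), mvfderiv_const]
  simp

lemma IsParallelConnection.pull (hD' : L.IsParallelConnection D D')
    (hX : IsParallelBasisOn D Ω X U) {y : L.carrier} (hy : L.incl y ∈ U) (i : Fin p)
    (v : TangentSpace (𝓡 p) y) : D' (L.pull (X i)) y v = 0 := by
  have := hD'.sum_smul_pull hX hy (Pi.single i 1) v
  simpa [Pi.single_apply] using this

lemma IsParallelConnection.smooth (h : Ω.IsRegularlySelfStable D)
    (hD' : L.IsParallelConnection D D') : D'.ContMDiffCovariantDerivative ∞ := by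
  refine ⟨⟨fun {σ} hσ y _ ↦ (contMDiffAt_endomorphism fun V hV ↦ ?_).contMDiffWithinAt⟩⟩
  have hσs : ∀ z, SmoothFieldAt σ z := fun z ↦
    (hσ z (mem_univ z)).contMDiffAt Filter.univ_mem |>.of_le (by simp)
  obtain ⟨X, U, hy, hX⟩ := h.exists_isParallelBasisOn (L.incl y)
  obtain ⟨θ, hθ⟩ := L.exists_coeff_pull hX hy
  have e : ∀ᶠ z in 𝓝 y, D' σ z (V z)
      = ∑ i, mvfderiv (𝓡 p) (fun w ↦ θ w (σ w)) z (V z) i • L.pull (X i) z := by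
    filter_upwards [hθ.eventually_nhds, L.eventually_incl_mem hX.isOpen hy] with z hz hzU
    exact hD' X U hX z hzU σ _ (hz.self_of_nhds.2.2 σ (hσs z).diffFieldAt)
      (hz.mono fun w hw ↦ hw.1 _) _
  refine (SmoothFieldAt.sum_smul (contMDiffAt_mvfderiv_apply
    (hθ.self_of_nhds.2.1 σ (hσs y)) hV.self_of_nhds)
    fun i ↦ smoothFieldAt_pull hX i hy).congr_of_eventuallyEq ?_
  filter_upwards [e] with z hz
  rw [hz]

lemma IsParallelConnection.torsion_eq_zero (h : Ω.IsRegularlySelfStable D) (ht : D.torsion = 0)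
    (hD' : L.IsParallelConnection D D') : D'.torsion = 0 := by
  funext y
  obtain ⟨X, U, hy, hX⟩ := h.exists_isParallelBasisOn (L.incl y)
  obtain ⟨θ, hθ⟩ := L.exists_coeff_pull hX hy
  have hd : ∀ a : Fin p → ℝ, DiffFieldAt (fun z ↦ ∑ i, a i • L.pull (X i) z) y := fun a ↦
    DiffFieldAt.sum_smul (f := fun _ ↦ a) mdifferentiableAt_const
      fun i ↦ (smoothFieldAt_pull hX i hy).diffFieldAt
  have hdX : ∀ a : Fin p → ℝ, DiffFieldAt (fun z ↦ ∑ i, a i • X i z) (L.incl y) := fun a ↦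
    DiffFieldAt.sum_smul (f := fun _ ↦ a) mdifferentiableAt_const fun i ↦ hX.diffFieldAt i hy
  have hpush : ∀ a : Fin p → ℝ, ∀ᶠ z in 𝓝 y, L.push z (∑ i, a i • L.pull (X i) z)
      = ∑ i, a i • X i (L.incl z) := fun a ↦ by
    filter_upwards [L.eventually_incl_mem hX.isOpen hy] with z hz using L.push_sum_pull hX hz a
  have hpar : ∀ a b : Fin p → ℝ, D (fun z ↦ ∑ i, a i • X i z) (L.incl y)
      (∑ i, b i • X i (L.incl y)) = 0 := by
    intro a b
    rw [← L.push_sum_pull hX hy, L.covariantDerivative_push hX hy (hdX a) (f := fun _ ↦ a)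
      mdifferentiableAt_const (Filter.Eventually.of_forall fun _ ↦ rfl), mvfderiv_const]
    simp
  ext1 v
  ext1 w
  rw [hθ.self_of_nhds.1 v, hθ.self_of_nhds.1 w]
  refine (D'.torsion_apply (hd (θ y v)) (hd (θ y w))).trans ?_
  rw [hD'.sum_smul_pull hX hy, hD'.sum_smul_pull hX hy, sub_zero, zero_sub]
  refine neg_eq_zero.2 (L.push_injective y ?_)
  rw [L.push_mlieBracket (hd _) (hd _) (hdX _) (hdX _) (hpush _) (hpush _),
    mlieBracket_eq_of_torsion_eq_zero ht (hdX _) (hdX _), hpar, hpar, sub_zero, map_zero]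

/-- The scalar products of parallel fields are constant along the leaf. -/
lemma mvfderiv_inner_eq_zero {g : PseudoRiemannianMetric n M} (hD : IsLeviCivita g D)
    (hX : IsParallelBasisOn D Ω X U) {y : L.carrier} (hy : L.incl y ∈ U) (i j : Fin p) :
    MDifferentiableAt (𝓡 p) 𝓘(ℝ, ℝ)
      (fun z ↦ g.inner (L.incl z) (X i (L.incl z)) (X j (L.incl z))) y ∧
    ∀ v, mvfderiv (𝓡 p) (fun z ↦ g.inner (L.incl z) (X i (L.incl z)) (X j (L.incl z))) y v = 0 := by
  have hd : MDifferentiableAt (𝓡 n) 𝓘(ℝ, ℝ) (fun x ↦ g.inner x (X i x) (X j x)) (L.incl y) := by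
    have h1 := MDifferentiableAt.clm_bundle_apply₂ (F₁ := EuclideanSpace ℝ (Fin n))
      (F₂ := EuclideanSpace ℝ (Fin n)) (F₃ := ℝ) (E₃ := fun _ : M ↦ ℝ)
      (ψ := fun x ↦ g.inner x) (b := id)
      ((g.contMDiff.mdifferentiable (by simp)) (L.incl y)) (hX.diffFieldAt i hy)
      (hX.diffFieldAt j hy)
    simpa [mdifferentiableAt_totalSpace] using ((mdifferentiableAt_totalSpace _ _).1 h1).2
  refine ⟨hd.comp y (L.mdifferentiableAt_incl y), fun v ↦ ?_⟩
  rw [mvfderiv_comp_mfderiv (h := fun x ↦ g.inner x (X i x) (X j x)) hd (L.mdifferentiableAt_incl y)]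
  refine (hD.metric _ (X i) (X j) (hX.diffFieldAt i hy) (hX.diffFieldAt j hy) _).trans ?_
  have h0 := fun i ↦ hX.parallel _ hy _ (L.push_mem y v) i
  rw [push] at h0
  simp only [h0, map_zero, zero_apply, add_zero]

lemma IsParallelConnection.push_eq (hD' : L.IsParallelConnection D D')
    (hX : IsParallelBasisOn D Ω X U) {y : L.carrier} (hy : L.incl y ∈ U) {Y : VField p L.carrier}
    {f : L.carrier → Fin p → ℝ} (hf : MDifferentiableAt (𝓡 p) 𝓘(ℝ, Fin p → ℝ) f y)
    (hY : ∀ᶠ z in 𝓝 y, Y z = ∑ i, f z i • L.pull (X i) z) (v : TangentSpace (𝓡 p) y) :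
    L.push y (D' Y y v) = ∑ i, mvfderiv (𝓡 p) f y v i • X i (L.incl y) := by
  rw [hD' X U hX y hy Y f hf hY, L.push_sum_pull hX hy]

/-- In terms of parallel fields, this is the Leibniz rule for a bilinear form with constant
coefficients, which may be degenerate. -/
lemma IsParallelConnection.metric (h : Ω.IsRegularlySelfStable D)
    (hD' : L.IsParallelConnection D D') {g : PseudoRiemannianMetric n M} (hD : IsLeviCivita g D)
    (y : L.carrier) (Y Z : VField p L.carrier) (hY : DiffFieldAt Y y) (hZ : DiffFieldAt Z y)
    (v : TangentSpace (𝓡 p) y) :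
    mvfderiv (𝓡 p) (fun z ↦ L.inducedForm g z (Y z) (Z z)) y v
      = L.inducedForm g y (D' Y y v) (Z y) + L.inducedForm g y (Y y) (D' Z y v) := by
  obtain ⟨X, U, hy, hX⟩ := h.exists_isParallelBasisOn (L.incl y)
  obtain ⟨θ, hθ⟩ := L.exists_coeff_pull hX hy
  have hf := hθ.self_of_nhds.2.2 Y hY
  have hk := hθ.self_of_nhds.2.2 Z hZ
  have hYe : ∀ᶠ z in 𝓝 y, Y z = ∑ i, θ z (Y z) i • L.pull (X i) z := hθ.mono fun z hz ↦ hz.1 _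
  have hZe : ∀ᶠ z in 𝓝 y, Z z = ∑ i, θ z (Z z) i • L.pull (X i) z := hθ.mono fun z hz ↦ hz.1 _
  have hpush : ∀ W : VField p L.carrier, ∀ᶠ z in 𝓝 y,
      L.push z (W z) = ∑ i, θ z (W z) i • X i (L.incl z) := fun W ↦ by
    filter_upwards [hθ, L.eventually_incl_mem hX.isOpen hy] with z hz hzU
    rw [← L.push_sum_pull hX hzU, ← hz.1 (W z)]
  have hsum : ∀ z (a b : Fin p → ℝ), g.inner (L.incl z) (∑ i, a i • X i (L.incl z))
      (∑ j, b j • X j (L.incl z))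
      = ∑ i, ∑ j, a i * b j * g.inner (L.incl z) (X i (L.incl z)) (X j (L.incl z)) := by
    intro z a b
    simp only [map_sum, map_smul, sum_apply, smul_apply, smul_eq_mul, Finset.mul_sum]
    rw [Finset.sum_comm]
    exact Finset.sum_congr rfl fun i _ ↦ Finset.sum_congr rfl fun j _ ↦ by ring
  have e : (fun z ↦ L.inducedForm g z (Y z) (Z z)) =ᶠ[𝓝 y] fun z ↦ ∑ i, ∑ j,
      θ z (Y z) i * θ z (Z z) j * g.inner (L.incl z) (X i (L.incl z)) (X j (L.incl z)) := by
    filter_upwards [hpush Y, hpush Z] with z h1 h2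
    rw [inducedForm, h1, h2, hsum]
  have hfi := fun i ↦ mvfderiv_pi_apply hf v i
  have hki := fun i ↦ mvfderiv_pi_apply hk v i
  have hb := fun i j ↦ L.mvfderiv_inner_eq_zero hD hX hy i j
  have hterm : ∀ i j, MDifferentiableAt (𝓡 p) 𝓘(ℝ, ℝ) (fun z ↦ θ z (Y z) i * θ z (Z z) j
      * g.inner (L.incl z) (X i (L.incl z)) (X j (L.incl z))) y := fun i j ↦
    ((hfi i).1.mul (hki j).1).mul (hb i j).1
  rw [mvfderiv_congr e, (mvfderiv_finset_sum (f := fun i z ↦ ∑ j, θ z (Y z) i * θ z (Z z) j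
      * g.inner (L.incl z) (X i (L.incl z)) (X j (L.incl z))) Finset.univ
    (fun i ↦ (mvfderiv_finset_sum Finset.univ (hterm i) v).1) v).2]
  rw [inducedForm, inducedForm, hD'.push_eq hX hy hf hYe, hD'.push_eq hX hy hk hZe,
    (hpush Y).self_of_nhds, (hpush Z).self_of_nhds, hsum, hsum, ← Finset.sum_add_distrib]
  refine Finset.sum_congr rfl fun i _ ↦ ?_
  rw [(mvfderiv_finset_sum Finset.univ (hterm i) v).2, ← Finset.sum_add_distrib]
  refine Finset.sum_congr rfl fun j _ ↦ ?_
  rw [mvfderiv_mul_mul_apply (hfi i).1 (hki j).1 (hb i j).1, (hfi i).2, (hki j).2, (hb i j).2]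
  ring

theorem IsParallelConnection.isInducedConnection (h : Ω.IsRegularlySelfStable D)
    (hD' : L.IsParallelConnection D D') {g : PseudoRiemannianMetric n M} (hD : IsLeviCivita g D) :
    L.IsInducedConnection g D D' where
  torsionFreeMetric :=
    { smooth := hD'.smooth h
      torsion_eq_zero := hD'.torsion_eq_zero h hD.torsion_eq_zero
      metric := hD'.metric h hD }
  restriction _ := by
    intro W hW V hV hWV Y' Y hY' hY hYY y hy v
    obtain ⟨X, U, hyU, hX⟩ := h.exists_isParallelBasisOn (L.incl y)
    obtain ⟨θ, hθ⟩ := L.exists_coeff_pull hX hyU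
    have hf := hθ.self_of_nhds.2.2 Y' (hY'.smoothFieldAt hW hy).diffFieldAt
    rw [hD'.push_eq hX hyU hf (hθ.mono fun z hz ↦ hz.1 _),
      L.covariantDerivative_push hX hyU (hY.smoothFieldAt hV (hWV hy)).diffFieldAt hf]
    filter_upwards [hθ, L.eventually_incl_mem hX.isOpen hyU, hW.mem_nhds hy] with z hz hzU hzW
    rw [← L.push_sum_pull hX hzU, ← hz.1 (Y' z), hYY z hzW]

theorem IsParallelConnection.isFlatConnection (h : Ω.IsRegularlySelfStable D)
    (hD' : L.IsParallelConnection D D') : IsFlatConnection D' := by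
  intro W hW V Y Z hV hY hZ y hy
  obtain ⟨X, U, hyU, hX⟩ := h.exists_isParallelBasisOn (L.incl y)
  obtain ⟨θ, hθ⟩ := L.exists_coeff_pull hX hyU
  have hU := L.eventually_incl_mem hX.isOpen hyU
  refine riemannCurvature_eq_zero_of_parallel D' (X := fun i ↦ L.pull (X i))
    (f := fun z ↦ θ z (V z)) (fun i ↦ hU.mono fun z hz ↦ smoothFieldAt_pull hX i hz) ?_
    (hθ.mono fun z hz ↦ hz.1 _) (hY.smoothFieldAt hW hy) (hZ.smoothFieldAt hW hy)
    (fun i ↦ hU.mono fun z hz ↦ hD'.pull hX hz i _) (fun i ↦ hU.mono fun z hz ↦ hD'.pull hX hz i _)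
    fun i ↦ hD'.pull hX hyU i _
  filter_upwards [hθ, hW.mem_nhds hy] with z hz hzW
  exact hz.2.1 V (hV.smoothFieldAt hW hzW)

end ParallelConnection

end Leaf

end TangentDistribution

/-! ### Totally geodesic and flat leaves -/

namespace TangentDistribution

variable {n p : ℕ} {M : Type u} [TopologicalSpace M]
  [ChartedSpace (EuclideanSpace ℝ (Fin n)) M] [IsManifold (𝓡 n) ∞ M]
  {Ω : TangentDistribution n M p} {D : AffineConnection n M}

theorem IsRegularlySelfStable.isTotallyGeodesic (h : Ω.IsRegularlySelfStable D) :
    Ω.IsTotallyGeodesic D := by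
  intro L W hW V hV hWV Y hY hYt y hy v
  obtain ⟨X, U, hyU, hX⟩ := h.exists_isParallelBasisOn (L.incl y)
  obtain ⟨θ, hθ⟩ := hX.basis.exists_coeff hX.isOpen hyU
  have hYd := (hY.smoothFieldAt hV (hWV hy)).diffFieldAt
  have hf : MDifferentiableAt (𝓡 p) 𝓘(ℝ, Fin p → ℝ)
      (fun z ↦ θ (L.incl z) (Y (L.incl z))) y :=
    (hθ.self_of_nhds.2.2 Y hYd).comp y (L.mdifferentiableAt_incl y)
  rw [L.mem_range_push, L.covariantDerivative_push hX hyU hYd hf]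
  · exact hX.basis.sum_mem hyU _
  · filter_upwards [L.continuous_incl.continuousAt.eventually hθ, hW.mem_nhds hy] with z hz hzW
    exact hz.1 _ (L.mem_range_push.1 (hYt z hzW))

theorem IsRegularlySelfStable.isFlat (h : Ω.IsRegularlySelfStable D)
    {g : PseudoRiemannianMetric n M} (hD : IsLeviCivita g D) : Ω.IsFlat g D := by
  intro L
  obtain ⟨D', hD'⟩ := L.exists_isParallelConnection h
  exact ⟨D', hD'.isInducedConnection h hD, hD'.isFlatConnection h⟩

theorem IsTotallyGeodesic.isSelfStable (h : Ω.IsTotallyGeodesic D) (hΩ : Ω.IsFoliation) :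
    Ω.IsSelfStable D := by
  intro U hU X Y hX hY x hx
  obtain ⟨L, y, rfl⟩ := hΩ x
  obtain ⟨v, hv⟩ := L.mem_range_push.2 (hY.mem _ hx)
  rw [covField, ← hv, ← L.mem_range_push]
  exact h L (L.incl ⁻¹' U) (hU.preimage L.continuous_incl) U hU (fun _ hz ↦ hz) X hX.smooth
    (fun z hz ↦ L.mem_range_push.2 (hX.mem _ hz)) y hx v

/-- The Gauss equation for a totally geodesic leaf: its curvature is the restriction of the
curvature of the ambient connection. -/
theorem Leaf.push_riemannCurvature [T2Space M] {L : Ω.Leaf} {D' : AffineConnection p L.carrier}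
    (hD : D.ContMDiffCovariantDerivative ∞) (hs : Ω.IsSelfStable D) (hr : L.IsRestriction D D')
    {U : Set M} (hU : IsOpen U) {X Y Z : VField n M} (hX : Ω.IsFieldOn X U)
    (hY : Ω.IsFieldOn Y U) (hZ : Ω.IsFieldOn Z U) {y : L.carrier} (hy : L.incl y ∈ U) :
    L.push y (riemannCurvature D' (L.pull Y) (L.pull Z) (L.pull X) y)
      = riemannCurvature D Y Z X (L.incl y) := by
  have hW := hU.preimage L.continuous_incl
  have hcov : ∀ {A' : VField p L.carrier} {A B : VField n M}, SmoothFieldOn A' (L.incl ⁻¹' U) →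
      Ω.IsFieldOn A U → Ω.IsFieldOn B U → (∀ z, L.incl z ∈ U → L.push z (A' z) = A (L.incl z)) →
      ∀ z, L.incl z ∈ U → L.push z (covField D' (L.pull B) A' z) = covField D B A (L.incl z) := by
    intro A' A B hA' hA hB hAA z hz
    rw [covField, hr _ hW U hU (fun _ hz ↦ hz) A' A hA' hA.smooth hAA z hz,
      L.push_pull (hB.mem _ hz)]
    rfl
  have hpush : ∀ {A : VField n M}, Ω.IsFieldOn A U → ∀ z, L.incl z ∈ U →
      L.push z (L.pull A z) = A (L.incl z) := fun hA z hz ↦ L.push_pull (hA.mem _ hz)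
  have hfield : ∀ {A B : VField n M}, Ω.IsFieldOn A U → Ω.IsFieldOn B U →
      Ω.IsFieldOn (covField D B A) U := fun hA hB ↦
    ⟨hA.smooth.covField hD hU hB.smooth, hs U hU _ _ hA hB⟩
  have hsm : ∀ {A B : VField n M}, Ω.IsFieldOn A U → Ω.IsFieldOn B U →
      SmoothFieldOn (covField D' (L.pull B) (L.pull A)) (L.incl ⁻¹' U) := by
    intro A B hA hB z hz
    refine (L.smoothFieldAt_of_push ((hfield hA hB).smooth.smoothFieldAt hU hz)
      ?_).contMDiffWithinAt
    filter_upwards [L.eventually_incl_mem hU hz] with w hw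
    exact hcov (L.smoothFieldOn_pull hU hA) hA hB (hpush hA) w hw
  have htwice : ∀ {B C : VField n M}, Ω.IsFieldOn B U → Ω.IsFieldOn C U →
      L.push y (covField D' (L.pull C) (covField D' (L.pull B) (L.pull X)) y)
        = covField D C (covField D B X) (L.incl y) := fun hB hC ↦
    hcov (hsm hX hB) (hfield hX hB) hC
      (hcov (L.smoothFieldOn_pull hU hX) hX hB (hpush hX)) y hy
  have hd : ∀ {A : VField n M}, Ω.IsFieldOn A U → DiffFieldAt (L.pull A) y := fun hA ↦
    ((L.smoothFieldOn_pull hU hA).smoothFieldAt hW hy).diffFieldAt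
  have hbr := L.push_mlieBracket (hd hY) (hd hZ) (hY.smooth.smoothFieldAt hU hy).diffFieldAt
    (hZ.smooth.smoothFieldAt hU hy).diffFieldAt
    ((L.eventually_incl_mem hU hy).mono (hpush hY)) ((L.eventually_incl_mem hU hy).mono (hpush hZ))
  have hthird : L.push y (covField D' (VectorField.mlieBracket (𝓡 p) (L.pull Y) (L.pull Z))
      (L.pull X) y) = covField D (VectorField.mlieBracket (𝓡 n) Y Z) X (L.incl y) := by
    rw [covField, hr _ hW U hU (fun _ hz ↦ hz) _ X (L.smoothFieldOn_pull hU hX) hX.smooth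
      (hpush hX) y hy, hbr]
    rfl
  simp only [riemannCurvature, Pi.sub_apply]
  rw [map_sub, map_sub, htwice hZ hY, htwice hY hZ, hthird]

theorem IsFlat.curvatureVanishesOn [T2Space M] {g : PseudoRiemannianMetric n M}
    (hD : D.ContMDiffCovariantDerivative ∞) (hF : Ω.IsFlat g D) (h : Ω.IsTotallyGeodesic D)
    (hΩ : Ω.IsFoliation) : Ω.CurvatureVanishesOn D := by
  intro U hU X Y Z hX hY hZ x hx
  obtain ⟨L, y, rfl⟩ := hΩ x
  obtain ⟨D', hD', hflat⟩ := hF L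
  rw [← L.push_riemannCurvature hD (h.isSelfStable hΩ) (hD'.restriction (h L)) hU hX hY hZ hx,
    hflat _ (hU.preimage L.continuous_incl) _ _ _ (L.smoothFieldOn_pull hU hX)
      (L.smoothFieldOn_pull hU hY) (L.smoothFieldOn_pull hU hZ) y hx, map_zero]

end TangentDistribution

end

theorem corollary2 {n p : ℕ} {M : Type u} [TopologicalSpace M] [T2Space M]
    [ChartedSpace (EuclideanSpace ℝ (Fin n)) M] [IsManifold (𝓡 n) ∞ M]
    (g : PseudoRiemannianMetric n M) (D : AffineConnection n M) (hD : IsLeviCivita g D)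
    (Ω : TangentDistribution n M p) (hΩ : Ω.IsFoliation) :
    (Ω.IsSelfStable D → (Ω.IsRegularlySelfStable D ↔ Ω.CurvatureVanishesOn D)) ∧
    (Ω.IsRegularlySelfStable D ↔ Ω.IsTotallyGeodesic D ∧ Ω.IsFlat g D) := by
  refine ⟨fun hs ↦ ⟨fun h ↦ h.curvatureVanishesOn hD.torsion_eq_zero,
    hs.isRegularlySelfStable hD.smooth hD.torsion_eq_zero⟩,
    fun h ↦ ⟨h.isTotallyGeodesic, h.isFlat hD⟩, fun ⟨hG, hF⟩ ↦ ?_⟩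
  exact (hG.isSelfStable hΩ).isRegularlySelfStable hD.smooth hD.torsion_eq_zero
    (hF.curvatureVanishesOn hD.smooth hG hΩ)
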